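/- Let $U$ be a unitary operator and $P$ an orthogonal projection on a complex Hilbert space $\mathcal H$ such that $A = UPU^* - P$ is compact. Assume that there is an antiunitary operator $\tau$ on $\mathcal H$ with $\tau^2 = -1$, $\tau U \tau^* = U^*$ and $\tau P \tau^* = P$. Then there is a unitary operator $W$ on $\mathcal H$ with $U - W$ compact and $\tau W \tau^* = W^*$ such that: - If $\dim\ker(A - 1)$ is even, then $[W, P] = 0$. - If $\dim\ker(A - 1)$ is odd, then $\mathcal H$ is an orthogonal direct sum $\mathcal H' \oplus \mathcal H''$ of closed subspaces, each invariant under $W$ and $P$, with respect to which $W = S \oplus W_{\mathrm{triv}}$, where $W_{\mathrm{triv}}$ commutes with the restriction of $P$ to $\mathcal H''$ and where the restriction of $W$ to $\mathcal H'$ is identified, through a unitary map, with the unitary $S$ on $\ell^2(\mathbb Z, \mathbb C^2)$ defined on the standard orthonormal basis $\{|x,\pm\rangle\}_{x\in\mathbb Z}$ by $S|x,\pm\rangle = |x\pm 1,\pm\rangle$ (a pair of opposite shifts). The spectrum of $S$ is purely absolutely continuous, and its absolutely continuous spectrum is the whole unit circle. Moreover, for every $0 < p < \infty$, if $A$ is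 Schatten-$p$ (its singular values are $p$-summable), then so is $U - W$, with the same $W$ for all $p$. -/

import Mathlib

open MeasureTheory
open scoped ENNReal InnerProductSpace

noncomputable section

/-! ### Singular values and Schatten classes -/

section Schatten

variable {H : Type*} [NormedAddCommGroup H] [InnerProductSpace ℂ H]

/-- The `n`-th singular value (counted from `0`, in decreasing order, with multiplicity) of a
bounded operator on a Hilbert space, as its `n`-th approximation number: the distance, in operator
norm, from `T` to the operators of rank at most `n`. -/
def singularValue (T : H →L[ℂ] H) (n : ℕ) : ℝ :=
  sInf {r : ℝ | ∃ F : H →L[ℂ] H, (F : H →ₗ[ℂ] H).rank ≤ (n : Cardinal) ∧ r = ‖T - F‖}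

/-- `T` belongs to the Schatten class `p` (used for `0 < p < ∞`): its singular values form a
`p`-summable sequence. -/
def IsSchatten (p : ℝ) (T : H →L[ℂ] H) : Prop :=
  Summable fun n : ℕ => singularValue T n ^ p

end Schatten

/-! ### Absolutely continuous spectrum of a unitary operator -/

section AcSpectrum

variable {H : Type*} [NormedAddCommGroup H] [InnerProductSpace ℂ H] [CompleteSpace H]

/-- The finite measure `μ` on the circle `ℝ / ℤ` (with `t` standing for the point `exp (2 π i t)`
of the unit circle) is the spectral measure of the unitary operator `W` at the vector `ψ`:
`⟪ψ, W ^ n ψ⟫ = ∫ exp (2 π i n t) dμ(t)` for all integers `n`. -/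
def IsSpectralMeasure (W : unitary (H →L[ℂ] H)) (ψ : H) (μ : Measure UnitAddCircle) : Prop :=
  IsFiniteMeasure μ ∧
    ∀ n : ℤ, ⟪ψ, ((W ^ n : unitary (H →L[ℂ] H)) : H →L[ℂ] H) ψ⟫_ℂ = ∫ t, fourier n t ∂μ

/-- The vectors whose spectral measure is absolutely continuous with respect to the arc length. -/
def acVectors (W : unitary (H →L[ℂ] H)) : Set H :=
  {ψ | ∃ μ : Measure UnitAddCircle, IsSpectralMeasure W ψ μ ∧ μ ≪ volume}

/-- The absolutely continuous subspace of `W`. -/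
def acSubspace (W : unitary (H →L[ℂ] H)) : Submodule ℂ H :=
  (Submodule.span ℂ (acVectors W)).topologicalClosure

theorem apply_mem_acVectors (W : unitary (H →L[ℂ] H)) {ψ : H} (hψ : ψ ∈ acVectors W) :
    (W : H →L[ℂ] H) ψ ∈ acVectors W := by
  obtain ⟨μ, ⟨hμ, h⟩, hac⟩ := hψ
  refine ⟨μ, ⟨hμ, fun n => ?_⟩, hac⟩
  rw [← h n, ← mul_apply_eq_comp, ← Submonoid.coe_mul, ← zpow_add_one,
    add_comm, zpow_one_add, Submonoid.coe_mul, mul_apply_eq_comp]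
  exact ContinuousLinearMap.inner_map_map_of_mem_unitary W.2 _ _

theorem mapsTo_acSubspace (W : unitary (H →L[ℂ] H)) :
    Set.MapsTo (W : H →L[ℂ] H) (acSubspace W) (acSubspace W) := by
  have h : Set.MapsTo (W : H →L[ℂ] H) (Submodule.span ℂ (acVectors W) : Set H)
      (Submodule.span ℂ (acVectors W)) := by
    intro x hx
    have : Submodule.span ℂ (acVectors W) ≤
        (Submodule.span ℂ (acVectors W)).comap ((W : H →L[ℂ] H) : H →ₗ[ℂ] H) :=
      Submodule.span_le.2 fun ψ hψ => Submodule.subset_span (apply_mem_acVectors W hψ)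
    exact this hx
  exact h.closure (W : H →L[ℂ] H).continuous

/-- The absolutely continuous spectrum of `W`: the spectrum of the restriction of `W` to its
absolutely continuous subspace. -/
def acSpectrum (W : unitary (H →L[ℂ] H)) : Set ℂ :=
  spectrum ℂ ((W : H →L[ℂ] H).restrict (mapsTo_acSubspace W) : acSubspace W →L[ℂ] acSubspace W)

end AcSpectrum

/-! ### The pair of opposite shifts -/

/-- The Hilbert space `ℓ²(ℤ, ℂ²)` with its orthonormal basis `|x, σ⟩`, where `x` is an integer and
the spin `σ` is `1` (up) or `-1` (down). -/
abbrev SpinChain : Type := lp (fun _ : ℤ × ℤˣ => ℂ) 2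

/-- The bijection `(x, σ) ↦ (x + σ, σ)` of the labels of the basis. -/
def shiftLabel : ℤ × ℤˣ ≃ ℤ × ℤˣ where
  toFun i := (i.1 + (i.2 : ℤ), i.2)
  invFun i := (i.1 - (i.2 : ℤ), i.2)
  left_inv i := by simp
  right_inv i := by simp

theorem memlp_comp (e : ℤ × ℤˣ ≃ ℤ × ℤˣ) (f : SpinChain) :
    Memℓp (fun i => f (e i) : ℤ × ℤˣ → ℂ) 2 :=
  memℓp_gen ((e.summable_iff).2 ((lp.memℓp f).summable (by norm_num)))

/-- The unitary `S` with `S |x, ±⟩ = |x ± 1, ±⟩`, as an isometric isomorphism; in coordinates,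
`(S f) (x, σ) = f (x - σ, σ)`. -/
def oppositeShiftsEquiv : SpinChain ≃ₗᵢ[ℂ] SpinChain where
  toFun f := ⟨fun i => f (shiftLabel.symm i), memlp_comp shiftLabel.symm f⟩
  invFun f := ⟨fun i => f (shiftLabel i), memlp_comp shiftLabel f⟩
  left_inv f := by ext i; simp
  right_inv f := by ext i; simp
  map_add' f g := rfl
  map_smul' c f := rfl
  norm_map' f := by
    rw [lp.norm_eq_tsum_rpow (by norm_num), lp.norm_eq_tsum_rpow (by norm_num)]
    congr 1
    exact shiftLabel.symm.tsum_eq fun i => ‖f i‖ ^ (2 : ℝ≥0∞).toReal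

/-- The unitary `S`, acting as the right shift on spin up and as the left shift on spin down. -/
def oppositeShifts : unitary (SpinChain →L[ℂ] SpinChain) :=
  Unitary.linearIsometryEquiv.symm oppositeShiftsEquiv

end

open MeasureTheory
open scoped ENNReal InnerProductSpace

noncomputable section

/-! ### Singular values and Schatten classes -/

section Schatten

variable {H : Type*} [NormedAddCommGroup H] [InnerProductSpace ℂ H]

/-! Put `Q = U P U*` and `θ = U τ`. Then `θ` is antiunitary, `θ² = -1` and `θ P = Q θ`. If `V` is
unitary with `θ V = V* θ`, then `W = V U` satisfies `τ W τ* = W*`, and `V Q = P V` means exactly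
that `W` commutes with `P`. So the problem concerns two projections with compact difference `A = Q -
P`, exchanged by `θ`, and a symmetric `V` close to `1` that intertwines them; this is
`exists_decoupling`.

With `B = 1 - P - Q` one has `A² + B² = 1`. Hence `ker B = ker (A - 1) ⊕ ker (A + 1)` is
finite-dimensional, and away from it the phase of `X = 1 - P - Q + 2PQ` is the intertwiner
(`exists_partialIsometry_intertwining`). On `ker B` the two eigenspaces must be swapped. The map `θ`
swaps them, but antilinearly; composing it with an antiunitary of square `-1` on `ker (A - 1)` gives
a linear swap. Such a structure needs even dimension (`exists_quaternionic_structure`). In odd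
dimension one unit vector `f` of `ker (A - 1)` is left over, and `V` is the identity on the span of
`f` and `θ f`.

In that case `W P - P W` lives on one Kramers pair. For `u = θ f` the vectors `W ^ n u` lie in the
range of `P` for `n ≥ 0` and in its kernel for `n < 0`, which makes them orthonormal; applying `τ`
gives a second chain, orthogonal to the first by Kramers degeneracy. Together they carry the two
opposite shifts (`exists_oppositeShifts`).

Finally `1 - V` is a sum of products, each containing a finite-rank factor or `A`. The same formula
gives compactness and every Schatten bound at once. -/

theorem singularValue_nonneg (T : H →L[ℂ] H) (n : ℕ) : 0 ≤ singularValue T n :=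
  Real.sInf_nonneg (by rintro r ⟨F, -, rfl⟩; exact norm_nonneg _)

theorem singularValue_le {T F : H →L[ℂ] H} {n : ℕ}
    (hF : (F : H →ₗ[ℂ] H).rank ≤ (n : Cardinal)) : singularValue T n ≤ ‖T - F‖ :=
  csInf_le ⟨0, by rintro r ⟨F, -, rfl⟩; exact norm_nonneg _⟩ ⟨F, hF, rfl⟩

theorem exists_norm_sub_lt_singularValue_add (T : H →L[ℂ] H) (n : ℕ) {ε : ℝ} (hε : 0 < ε) :
    ∃ F : H →L[ℂ] H, (F : H →ₗ[ℂ] H).rank ≤ (n : Cardinal) ∧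
      ‖T - F‖ < singularValue T n + ε := by
  obtain ⟨r, ⟨F, hF, rfl⟩, h⟩ := exists_lt_of_csInf_lt
    (s := {r : ℝ | ∃ F : H →L[ℂ] H, (F : H →ₗ[ℂ] H).rank ≤ (n : Cardinal) ∧ r = ‖T - F‖})
    ⟨_, 0, by simp [LinearMap.rank_zero], rfl⟩ (lt_add_of_pos_right (singularValue T n) hε)
  exact ⟨F, hF, h⟩

theorem singularValue_antitone (T : H →L[ℂ] H) : Antitone (singularValue T) := by
  intro m n hmn
  refine le_of_forall_pos_le_add fun ε hε => ?_
  obtain ⟨F, hF, h⟩ := exists_norm_sub_lt_singularValue_add T m hε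
  exact (singularValue_le (hF.trans (by exact_mod_cast hmn))).trans h.le

theorem singularValue_add_le (S T : H →L[ℂ] H) (m n : ℕ) :
    singularValue (S + T) (m + n) ≤ singularValue S m + singularValue T n := by
  refine le_of_forall_pos_le_add fun ε hε => ?_
  obtain ⟨F, hF, h⟩ := exists_norm_sub_lt_singularValue_add S m (half_pos hε)
  obtain ⟨G, hG, h'⟩ := exists_norm_sub_lt_singularValue_add T n (half_pos hε)
  have hr : ((F + G : H →L[ℂ] H) : H →ₗ[ℂ] H).rank ≤ ((m + n : ℕ) : Cardinal) := by
    rw [ContinuousLinearMap.toLinearMap_add, Nat.cast_add]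
    exact (LinearMap.rank_add_le _ _).trans (add_le_add hF hG)
  refine (singularValue_le hr).trans ?_
  rw [add_sub_add_comm]
  linarith [norm_add_le (S - F) (T - G)]

theorem singularValue_mul_left_le (C T : H →L[ℂ] H) (n : ℕ) :
    singularValue (C * T) n ≤ ‖C‖ * singularValue T n := by
  have key : ∀ ε : ℝ, 0 < ε → singularValue (C * T) n ≤ ‖C‖ * (singularValue T n + ε) := by
    intro ε hε
    obtain ⟨F, hF, h⟩ := exists_norm_sub_lt_singularValue_add T n hε
    refine (singularValue_le (F := C * F) ((LinearMap.rank_comp_le_right _ _).trans hF)).trans ?_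
    rw [← mul_sub]
    exact (norm_mul_le _ _).trans (by gcongr)
  -- The error is multiplied by `‖C‖`, which may vanish; a limit avoids dividing by it.
  have hlim : Filter.Tendsto (fun ε : ℝ => ‖C‖ * (singularValue T n + ε)) (nhdsWithin 0 (Set.Ioi 0))
      (nhds (‖C‖ * (singularValue T n + 0))) :=
    (Continuous.tendsto (by fun_prop) 0).mono_left nhdsWithin_le_nhds
  simpa using ge_of_tendsto hlim (Filter.eventually_of_mem self_mem_nhdsWithin key)

theorem singularValue_mul_right_le (T C : H →L[ℂ] H) (n : ℕ) :
    singularValue (T * C) n ≤ singularValue T n * ‖C‖ := by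
  have key : ∀ ε : ℝ, 0 < ε → singularValue (T * C) n ≤ (singularValue T n + ε) * ‖C‖ := by
    intro ε hε
    obtain ⟨F, hF, h⟩ := exists_norm_sub_lt_singularValue_add T n hε
    refine (singularValue_le (F := F * C) ((LinearMap.rank_comp_le_left _ _).trans hF)).trans ?_
    rw [← sub_mul]
    exact (norm_mul_le _ _).trans (by gcongr)
  have hlim : Filter.Tendsto (fun ε : ℝ => (singularValue T n + ε) * ‖C‖) (nhdsWithin 0 (Set.Ioi 0))
      (nhds ((singularValue T n + 0) * ‖C‖)) :=
    (Continuous.tendsto (by fun_prop) 0).mono_left nhdsWithin_le_nhds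
  simpa using ge_of_tendsto hlim (Filter.eventually_of_mem self_mem_nhdsWithin key)

theorem summable_of_summable_two_mul {f : ℕ → ℝ} (hf : ∀ n, 0 ≤ f n) (ha : Antitone f)
    (h : Summable fun n => f (2 * n)) : Summable f := by
  have h' : Summable fun n => f (2 * n + 1) :=
    h.of_nonneg_of_le (fun n => hf _) fun n => ha (Nat.le_succ _)
  exact (h.hasSum.even_add_odd h'.hasSum).summable

/-- By monotonicity it suffices to sum over even indices, where the singular value of the sum at
`2n` is at most twice the larger of the two at `n`. No triangle inequality for a `p`-norm is used,
so `p < 1` is covered. -/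
theorem IsSchatten.add {p : ℝ} (hp : 0 < p) {S T : H →L[ℂ] H} (hS : IsSchatten p S)
    (hT : IsSchatten p T) : IsSchatten p (S + T) := by
  refine summable_of_summable_two_mul (fun n => Real.rpow_nonneg (singularValue_nonneg _ _) _)
    (fun m n hmn => Real.rpow_le_rpow (singularValue_nonneg _ _)
      (singularValue_antitone _ hmn) hp.le) ?_
  refine ((Summable.add hS hT).mul_left (2 ^ p)).of_nonneg_of_le
    (fun n => Real.rpow_nonneg (singularValue_nonneg _ _) _) fun n => ?_
  have h1 := singularValue_add_le S T n n
  have hs := singularValue_nonneg S n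
  have ht := singularValue_nonneg T n
  have hsp := Real.rpow_nonneg hs p
  have htp := Real.rpow_nonneg ht p
  rw [← two_mul] at h1
  have h2 : singularValue (S + T) (2 * n) ≤ 2 * max (singularValue S n) (singularValue T n) := by
    linarith [le_max_left (singularValue S n) (singularValue T n),
      le_max_right (singularValue S n) (singularValue T n)]
  refine (Real.rpow_le_rpow (singularValue_nonneg _ _) h2 hp.le).trans ?_
  rw [Real.mul_rpow zero_le_two (le_max_of_le_left hs)]
  gcongr
  rcases max_choice (singularValue S n) (singularValue T n) with h | h <;> rw [h] <;> linarith

theorem IsSchatten.mul_left {p : ℝ} (hp : 0 < p) {T : H →L[ℂ] H} (hT : IsSchatten p T)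
    (C : H →L[ℂ] H) : IsSchatten p (C * T) := by
  refine (Summable.mul_left (‖C‖ ^ p) hT).of_nonneg_of_le
    (fun n => Real.rpow_nonneg (singularValue_nonneg _ _) _) fun n => ?_
  rw [← Real.mul_rpow (norm_nonneg _) (singularValue_nonneg _ _)]
  exact Real.rpow_le_rpow (singularValue_nonneg _ _) (singularValue_mul_left_le C T n) hp.le

theorem IsSchatten.mul_right {p : ℝ} (hp : 0 < p) {T : H →L[ℂ] H} (hT : IsSchatten p T)
    (C : H →L[ℂ] H) : IsSchatten p (T * C) := by
  refine (Summable.mul_right (‖C‖ ^ p) hT).of_nonneg_of_le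
    (fun n => Real.rpow_nonneg (singularValue_nonneg _ _) _) fun n => ?_
  rw [← Real.mul_rpow (singularValue_nonneg _ _) (norm_nonneg _)]
  exact Real.rpow_le_rpow (singularValue_nonneg _ _) (singularValue_mul_right_le T C n) hp.le

theorem isSchatten_of_finiteDimensional_range {p : ℝ} (hp : 0 < p) (F : H →L[ℂ] H)
    [FiniteDimensional ℂ (LinearMap.range (F : H →ₗ[ℂ] H))] : IsSchatten p F := by
  refine summable_of_ne_finset_zero
    (s := Finset.range (Module.finrank ℂ (LinearMap.range (F : H →ₗ[ℂ] H)))) fun n hn => ?_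
  have h : (F : H →ₗ[ℂ] H).rank ≤ (n : Cardinal) := by
    rw [LinearMap.rank, ← Module.finrank_eq_rank]
    exact_mod_cast not_lt.1 fun h => hn (Finset.mem_range.2 h)
  have h0 : singularValue F n = 0 :=
    le_antisymm (by simpa using singularValue_le (T := F) h) (singularValue_nonneg _ _)
  simp only [h0, Real.zero_rpow hp.ne']

end Schatten

/-! ### Finite-rank operators are compact -/

section FiniteRank

variable {H : Type*} [NormedAddCommGroup H] [NormedSpace ℂ H]

theorem isCompactOperator_of_finiteDimensional_range (F : H →L[ℂ] H)
    [FiniteDimensional ℂ (LinearMap.range (F : H →ₗ[ℂ] H))] : IsCompactOperator F := by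
  let F' : H →L[ℂ] LinearMap.range (F : H →ₗ[ℂ] H) := F.codRestrict _ fun x => ⟨x, rfl⟩
  have : ProperSpace (LinearMap.range (F : H →ₗ[ℂ] H)) := FiniteDimensional.proper ℂ _
  have h : IsCompactOperator (id : LinearMap.range (F : H →ₗ[ℂ] H) → _) :=
    ⟨Metric.closedBall 0 1, isCompact_closedBall _ _, Metric.closedBall_mem_nhds _ one_pos⟩
  exact (h.comp_clm F').clm_comp (LinearMap.range (F : H →ₗ[ℂ] H)).subtypeL

end FiniteRank

/-! ### Spectral theory of the pair of opposite shifts -/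

section OppositeShifts

theorem oppositeShifts_apply (f : SpinChain) (i : ℤ × ℤˣ) :
    ((oppositeShifts : SpinChain →L[ℂ] SpinChain) f) i = f (shiftLabel.symm i) := rfl

theorem oppositeShifts_inv_apply (f : SpinChain) (i : ℤ × ℤˣ) :
    (((oppositeShifts⁻¹ : unitary (SpinChain →L[ℂ] SpinChain)) : SpinChain →L[ℂ] SpinChain) f) i =
      f (shiftLabel i) := by
  have h : (oppositeShifts : SpinChain →L[ℂ] SpinChain)
      (((oppositeShifts⁻¹ : unitary (SpinChain →L[ℂ] SpinChain)) :
        SpinChain →L[ℂ] SpinChain) f) = f := by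
    rw [← mul_apply_eq_comp, ← Submonoid.coe_mul, mul_inv_cancel]; rfl
  conv_rhs => rw [← h]
  rw [oppositeShifts_apply, Equiv.symm_apply_apply]

theorem oppositeShifts_zpow_apply (n : ℤ) (f : SpinChain) (i : ℤ × ℤˣ) :
    (((oppositeShifts ^ n : unitary (SpinChain →L[ℂ] SpinChain)) : SpinChain →L[ℂ] SpinChain) f) i =
      f (i.1 - n * (i.2 : ℤ), i.2) := by
  induction n using Int.induction_on generalizing i with
  | zero => simp
  | succ n ih =>
    rw [add_comm, zpow_one_add, Submonoid.coe_mul, mul_apply_eq_comp, oppositeShifts_apply, ih]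
    simp only [shiftLabel, Equiv.coe_fn_symm_mk]
    ring_nf
  | pred n ih =>
    rw [sub_eq_add_neg, add_comm, zpow_add, zpow_neg_one, Submonoid.coe_mul, mul_apply_eq_comp,
      oppositeShifts_inv_apply, ih]
    simp only [shiftLabel, Equiv.coe_fn_mk]
    ring_nf

/-- A nonzero power of the shift sends a basis vector to a different one, so all moments vanish
except the zeroth; these are the Fourier coefficients of normalized arc length. -/
theorem isSpectralMeasure_single (i : ℤ × ℤˣ) :
    IsSpectralMeasure oppositeShifts (lp.single 2 i (1 : ℂ)) volume := by
  refine ⟨inferInstance, fun n => ?_⟩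
  rw [lp.inner_single_left, oppositeShifts_zpow_apply]
  have h := (orthonormal_iff_ite.1 (orthonormal_fourier (T := 1))) 0 n
  rw [ContinuousMap.inner_toLp] at h
  have hv : (AddCircle.haarAddCircle : Measure UnitAddCircle) = volume := by
    rw [AddCircle.volume_eq_smul_haarAddCircle]; simp
  simp only [hv, fourier_zero, map_one, mul_one] at h
  rw [h]
  rcases eq_or_ne n 0 with rfl | hn
  · simp
  · rw [if_neg hn.symm, lp.single_apply_ne]
    · simp
    · intro h
      have := congrArg Prod.fst h
      simp [hn] at this

theorem acSubspace_oppositeShifts : acSubspace oppositeShifts = ⊤ := by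
  rw [eq_top_iff]
  intro f _
  have hf := lp.hasSum_single (p := 2) (by norm_num) f
  refine (Submodule.isClosed_topologicalClosure _).mem_of_tendsto hf
    (Filter.Eventually.of_forall fun s => Submodule.sum_mem _ fun i _ => ?_)
  refine Submodule.le_topologicalClosure _ ?_
  have : lp.single 2 i (f i) = f i • lp.single (E := fun _ => ℂ) 2 i (1 : ℂ) := by
    rw [← lp.single_smul, smul_eq_mul, mul_one]
  rw [this]
  exact Submodule.smul_mem _ _ (Submodule.subset_span
    ⟨volume, isSpectralMeasure_single i, Measure.AbsolutelyContinuous.rfl⟩)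

theorem tendsto_norm_cofinite_zero (f : SpinChain) :
    Filter.Tendsto (fun i => ‖f i‖) Filter.cofinite (nhds 0) := by
  have h := ((lp.memℓp f).summable (by norm_num)).tendsto_cofinite_zero
  have h2 := h.sqrt
  simpa [Real.sqrt_sq] using h2

theorem apply_eq_zero_of_norm_const (f : SpinChain) {g : ℕ → ℤ × ℤˣ} (hg : Function.Injective g)
    (h : ∀ n, ‖f (g (n + 1))‖ = ‖f (g n)‖) : f (g 0) = 0 := by
  have hc : ∀ n, ‖f (g n)‖ = ‖f (g 0)‖ := fun n => by
    induction n with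
    | zero => rfl
    | succ n ih => rw [h, ih]
  have ht := (tendsto_norm_cofinite_zero f).comp (Nat.cofinite_eq_atTop ▸ hg.tendsto_cofinite)
  have : Filter.Tendsto (fun _ : ℕ => ‖f (g 0)‖) Filter.atTop (nhds 0) :=
    ht.congr fun n => hc n
  exact norm_eq_zero.1 (tendsto_nhds_unique tendsto_const_nhds this)

/-- A preimage of the spin-up basis vector at `0` would have constant modulus on the sites `≥ 0` and
on the sites `≤ -1`. Square summability makes it vanish on both half-lines, contradicting the
equation at `0`. -/
theorem not_surjective_sub_oppositeShifts {z : ℂ} (hz : ‖z‖ = 1) :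
    ¬ Function.Surjective fun f : SpinChain =>
      z • f - (oppositeShifts : SpinChain →L[ℂ] SpinChain) f := by
  intro hs
  obtain ⟨f, hf⟩ := hs (lp.single 2 ((0 : ℤ), (1 : ℤˣ)) 1)
  have key : ∀ k : ℤ, z * f (k, 1) - f (k - 1, 1) =
      (lp.single (E := fun _ => ℂ) 2 ((0 : ℤ), (1 : ℤˣ)) 1 : SpinChain) (k, 1) := by
    intro k
    rw [← hf]
    rfl
  have hk : ∀ k : ℤ, k ≠ 0 → ‖f (k, 1)‖ = ‖f (k - 1, 1)‖ := by
    intro k hk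
    have h := key k
    rw [lp.single_apply_ne _ _ _ (by simpa using hk), sub_eq_zero] at h
    rw [← h, norm_mul, hz, one_mul]
  have h0 : f (0, 1) = 0 := by
    refine apply_eq_zero_of_norm_const f (g := fun n : ℕ => ((n : ℤ), 1)) ?_ fun n => ?_
    · intro a b h; simpa using h
    · have := hk (n + 1) (by omega)
      simpa using this
  have h1 : f (-1, 1) = 0 := by
    refine apply_eq_zero_of_norm_const f (g := fun n : ℕ => (-1 - (n : ℤ), 1)) ?_ fun n => ?_
    · intro a b h; simpa using h
    · have := hk (-1 - n) (by omega)
      rw [this]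
      push_cast
      ring_nf
  have h := key 0
  rw [lp.single_apply_self, h0, zero_sub, h1] at h
  simp at h

theorem acSpectrum_oppositeShifts : acSpectrum oppositeShifts = Metric.sphere (0 : ℂ) 1 := by
  have hmem : ∀ f, f ∈ acSubspace oppositeShifts := fun f => by
    rw [acSubspace_oppositeShifts]; trivial
  have hc : CompleteSpace (acSubspace oppositeShifts) :=
    (Submodule.isClosed_topologicalClosure _).completeSpace_coe
  have hbij : ∀ z : ℂ, z ∉ acSpectrum oppositeShifts ↔ Function.Bijective fun f : SpinChain =>
      z • f - (oppositeShifts : SpinChain →L[ℂ] SpinChain) f := by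
    intro z
    rw [acSpectrum, spectrum.notMem_iff, ContinuousLinearMap.isUnit_iff_bijective]
    let e : acSubspace oppositeShifts ≃ SpinChain :=
      ⟨Subtype.val, fun f => ⟨f, hmem f⟩, fun _ => rfl, fun _ => rfl⟩
    rw [← e.comp_bijective, ← e.bijective_comp fun f : SpinChain =>
      z • f - (oppositeShifts : SpinChain →L[ℂ] SpinChain) f]
    rfl
  ext z
  rw [mem_sphere_zero_iff_norm]
  refine ⟨fun h => ?_, fun hz => ?_⟩
  · by_contra hz
    refine (hbij z).2 ?_ h
    have : z ∉ spectrum ℂ (oppositeShifts : SpinChain →L[ℂ] SpinChain) := fun h' =>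
      hz (mem_sphere_zero_iff_norm.1 (spectrum.subset_circle_of_unitary oppositeShifts.2 h'))
    rw [spectrum.notMem_iff, ContinuousLinearMap.isUnit_iff_bijective] at this
    exact this
  · by_contra h
    exact not_surjective_sub_oppositeShifts hz ((hbij z).1 h).2

end OppositeShifts

/-! ### Antiunitary operators of square `-1` -/

section Antiunitary

variable {H : Type*} [NormedAddCommGroup H] [InnerProductSpace ℂ H]

theorem inner_antiunitary (θ : H ≃ₗᵢ⋆[ℂ] H) (x y : H) : ⟪θ x, θ y⟫_ℂ = ⟪y, x⟫_ℂ := by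
  have hI : Complex.I • θ y = -θ (Complex.I • y) := by
    rw [map_smulₛₗ, Complex.conj_I, neg_smul, neg_neg]
  rw [inner_eq_sum_norm_sq_div_four, inner_eq_sum_norm_sq_div_four (𝕜 := ℂ) y x]
  simp only [RCLike.I_to_complex]
  rw [hI, sub_neg_eq_add, ← sub_eq_add_neg, ← map_add, ← map_sub, ← map_add, ← map_sub]
  simp only [LinearIsometryEquiv.norm_map]
  have h1 : ‖y - Complex.I • x‖ = ‖x + Complex.I • y‖ := by
    have : x + Complex.I • y = Complex.I • (y - Complex.I • x) := by
      rw [smul_sub, smul_smul, Complex.I_mul_I]; module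
    rw [this, norm_smul, Complex.norm_I, one_mul]
  have h2 : ‖y + Complex.I • x‖ = ‖x - Complex.I • y‖ := by
    have : x - Complex.I • y = (-Complex.I) • (y + Complex.I • x) := by
      rw [smul_add, smul_smul, neg_mul, Complex.I_mul_I]; module
    rw [this, norm_smul, norm_neg, Complex.norm_I, one_mul]
  rw [h1, h2, add_comm y x, norm_sub_rev y x]

variable {θ : H ≃ₗᵢ⋆[ℂ] H}

theorem inner_antiunitary_left (hθ : ∀ x, θ (θ x) = -x) (x y : H) :
    ⟪θ x, y⟫_ℂ = -⟪θ y, x⟫_ℂ := by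
  rw [← inner_antiunitary θ x (θ y), hθ, inner_neg_right, neg_neg]

/-- Kramers degeneracy: the form `⟪θ x, y⟫` is antisymmetric. -/
theorem inner_antiunitary_self (hθ : ∀ x, θ (θ x) = -x) (x : H) : ⟪θ x, x⟫_ℂ = 0 :=
  self_eq_neg.1 (inner_antiunitary_left hθ x x)

theorem antiunitary_symm_apply (hθ : ∀ x, θ (θ x) = -x) (x : H) : θ.symm x = -θ x := by
  rw [LinearIsometryEquiv.symm_apply_eq, map_neg, hθ, neg_neg]

end Antiunitary

section AntiunitaryConj

variable {H : Type*} [NormedAddCommGroup H] [InnerProductSpace ℂ H] {θ : H ≃ₗᵢ⋆[ℂ] H}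

/-- The conjugate of a bounded operator by an antiunitary operator. -/
def antiunitaryConj (θ : H ≃ₗᵢ⋆[ℂ] H) (T : H →L[ℂ] H) : H →L[ℂ] H :=
  ((θ : H ≃SL[starRingEnd ℂ] H) : H →SL[starRingEnd ℂ] H).comp
    (T.comp ((θ.symm : H ≃SL[starRingEnd ℂ] H) : H →SL[starRingEnd ℂ] H))

theorem antiunitaryConj_apply (T : H →L[ℂ] H) (x : H) :
    antiunitaryConj θ T x = θ (T (θ.symm x)) := rfl

theorem antiunitaryConj_mul (S T : H →L[ℂ] H) :
    antiunitaryConj θ (S * T) = antiunitaryConj θ S * antiunitaryConj θ T := by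
  ext x
  simp [antiunitaryConj_apply]

theorem inner_antiunitaryConj_apply (T : H →L[ℂ] H) (x y : H) :
    ⟪antiunitaryConj θ T x, y⟫_ℂ = ⟪θ.symm y, T (θ.symm x)⟫_ℂ := by
  rw [antiunitaryConj_apply, ← inner_antiunitary θ (T (θ.symm x)), LinearIsometryEquiv.apply_symm_apply]

end AntiunitaryConj

section Commutation

variable {H : Type*} [NormedAddCommGroup H] [InnerProductSpace ℂ H] [CompleteSpace H]
  {θ : H ≃ₗᵢ⋆[ℂ] H}

theorem inner_star_apply (T : H →L[ℂ] H) (x y : H) : ⟪star T x, y⟫_ℂ = ⟪x, T y⟫_ℂ := by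
  rw [ContinuousLinearMap.star_eq_adjoint, ContinuousLinearMap.adjoint_inner_left]

theorem inner_apply_of_isSelfAdjoint {T : H →L[ℂ] H} (hT : IsSelfAdjoint T) (x y : H) :
    ⟪T x, y⟫_ℂ = ⟪x, T y⟫_ℂ := by
  rw [← inner_star_apply, hT.star_eq]

theorem isSelfAdjoint_of_inner {T : H →L[ℂ] H} (h : ∀ x y, ⟪T x, y⟫_ℂ = ⟪x, T y⟫_ℂ) :
    IsSelfAdjoint T :=
  ContinuousLinearMap.isSelfAdjoint_iff_isSymmetric.2 h

/-- A projection whose range is invariant under a conjugation commutes with it. -/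
theorem apply_antiunitary_of_invariant (hθ : ∀ x, θ (θ x) = -x) {E : H →L[ℂ] H}
    (hE : IsSelfAdjoint E) (h : ∀ x, E (θ (E x)) = θ (E x)) (x : H) : θ (E x) = E (θ x) := by
  refine (ext_inner_right ℂ fun y => ?_).symm
  rw [inner_apply_of_isSelfAdjoint hE, inner_antiunitary_left hθ, ← h y,
    inner_apply_of_isSelfAdjoint hE, inner_antiunitary_left hθ, neg_neg,
    ← inner_apply_of_isSelfAdjoint hE, h]

theorem antiunitaryConj_star (T : H →L[ℂ] H) :
    antiunitaryConj θ (star T) = star (antiunitaryConj θ T) := by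
  refine ContinuousLinearMap.ext fun x => ext_inner_right ℂ fun y => ?_
  rw [inner_star_apply, inner_antiunitaryConj_apply, ← inner_conj_symm x,
    inner_antiunitaryConj_apply, inner_conj_symm, ← inner_conj_symm, inner_star_apply,
    inner_conj_symm]

theorem antiunitaryConj_nonneg {T : H →L[ℂ] H} (hT : 0 ≤ T) : 0 ≤ antiunitaryConj θ T := by
  rw [ContinuousLinearMap.nonneg_iff_isPositive, ContinuousLinearMap.isPositive_iff'] at *
  refine ⟨?_, fun x => ?_⟩
  · rw [IsSelfAdjoint, ← antiunitaryConj_star, hT.1.star_eq]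
  · rw [inner_antiunitaryConj_apply, ← inner_apply_of_isSelfAdjoint hT.1]
    exact hT.2 _

/-- The conjugate of the root by `θ` is again a nonnegative root of `G`, and such a root is unique.
-/
theorem antiunitary_apply_sqrt {G : H →L[ℂ] H} (hG : 0 ≤ G) (h : ∀ x, θ (G x) = G (θ x)) (x : H) :
    θ (CFC.sqrt G x) = CFC.sqrt G (θ x) := by
  have key : CFC.sqrt G = antiunitaryConj θ (CFC.sqrt G) := by
    refine CFC.sqrt_unique ?_ (antiunitaryConj_nonneg (CFC.sqrt_nonneg G))
    rw [← antiunitaryConj_mul, CFC.sqrt_mul_sqrt_self G hG]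
    ext x
    rw [antiunitaryConj_apply, h, LinearIsometryEquiv.apply_symm_apply]
  conv_rhs => rw [key, antiunitaryConj_apply, LinearIsometryEquiv.symm_apply_apply]

theorem commute_sqrt {G T : H →L[ℂ] H} (h : Commute G T) : Commute (CFC.sqrt G) T := by
  rw [CFC.sqrt_eq_cfc]
  exact h.cfc_nnreal _

end Commutation

/-! ### Quaternionic structures on finite-dimensional subspaces -/

section Quaternionic

variable {H : Type*} [NormedAddCommGroup H] [InnerProductSpace ℂ H]

/-- The operator is the antilinear rotation `a i ↦ c i`, `c i ↦ -a i`, extended by zero on the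
orthogonal complement. -/
theorem exists_skew_of_orthonormal {ι : Type*} [Fintype ι] {a c : ι → H} (ha : Orthonormal ℂ a)
    (hc : Orthonormal ℂ c) (hac : ∀ i j, ⟪a i, c j⟫_ℂ = 0) :
    ∃ T : H →L⋆[ℂ] H, (∀ x, T (T x) = -∑ i, (⟪a i, x⟫_ℂ • a i + ⟪c i, x⟫_ℂ • c i)) ∧
      (∀ x y, ⟪T x, y⟫_ℂ = -⟪T y, x⟫_ℂ) ∧
      (∀ x, ∑ i, (⟪a i, T x⟫_ℂ • a i + ⟪c i, T x⟫_ℂ • c i) = T x) := by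
  classical
  have hca : ∀ i j, ⟪c i, a j⟫_ℂ = 0 := fun i j => by rw [← inner_conj_symm, hac, map_zero]
  rw [orthonormal_iff_ite] at ha hc
  let T : H →L⋆[ℂ] H := ∑ i,
    ((ContinuousLinearMap.toSpanSingleton ℂ (c i)).comp (innerSLFlip ℂ (a i)) -
      (ContinuousLinearMap.toSpanSingleton ℂ (a i)).comp (innerSLFlip ℂ (c i)))
  have hT : ∀ x, T x = ∑ i, (⟪x, a i⟫_ℂ • c i - ⟪x, c i⟫_ℂ • a i) := fun x => by simp [T]
  have hTa : ∀ j, T (a j) = c j := fun j => by simp [hT, ha, hac]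
  have hTc : ∀ j, T (c j) = -a j := fun j => by simp [hT, hc, hca]
  refine ⟨T, fun x => ?_, fun x y => ?_, fun x => ?_⟩
  · rw [hT x, map_sum, ← Finset.sum_neg_distrib]
    refine Finset.sum_congr rfl fun i _ => ?_
    rw [map_sub, map_smulₛₗ, map_smulₛₗ, hTa, hTc, inner_conj_symm, inner_conj_symm]
    module
  · rw [hT, hT, sum_inner, sum_inner, ← Finset.sum_neg_distrib]
    refine Finset.sum_congr rfl fun i _ => ?_
    simp only [inner_sub_left, inner_smul_left, inner_conj_symm]
    ring
  · rw [hT x]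
    refine Finset.sum_congr rfl fun i _ => ?_
    simp [ha, hc, hac, hca]
    module

/-- On a finite-dimensional subspace, up to at most one dimension, there is an antiunitary operator
squaring to `-1`. -/
theorem exists_quaternionic_structure [CompleteSpace H] (K : Submodule ℂ H) [FiniteDimensional ℂ K] :
    ∃ (T : H →L⋆[ℂ] H) (F : H →L[ℂ] H), IsStarProjection F ∧ (∀ x, F x ∈ K) ∧
      (∀ x, T (T x) = -F x) ∧ (∀ x, F (T x) = T x) ∧ (∀ x y, ⟪T x, y⟫_ℂ = -⟪T y, x⟫_ℂ) ∧
      (Module.finrank ℂ K % 2 = 0 → ∀ x ∈ K, F x = x) ∧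
      (Module.finrank ℂ K % 2 = 1 → ∃ f ∈ K, ‖f‖ = 1 ∧ ∀ x ∈ K, x = F x + ⟪f, x⟫_ℂ • f) := by
  obtain ⟨m, r, hr, hm⟩ : ∃ m r, Module.finrank ℂ K % 2 = r ∧ Module.finrank ℂ K = m * 2 + r :=
    ⟨_, _, rfl, (Nat.div_add_mod' _ 2).symm⟩
  -- The basis is grouped into `m` pairs, on which `T` rotates, and `r ≤ 1` leftover vectors.
  let b : OrthonormalBasis ((Fin m × Fin 2) ⊕ Fin r) ℂ K :=
    (stdOrthonormalBasis ℂ K).reindex ((finCongr hm).trans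
      (finSumFinEquiv.symm.trans (Equiv.sumCongr finProdFinEquiv.symm (Equiv.refl _))))
  have hb : Orthonormal ℂ fun i => (b i : H) := b.orthonormal.comp_linearIsometry K.subtypeₗᵢ
  have hbK : ∀ i, (b i : H) ∈ K := fun i => (b i).2
  have hx : ∀ x ∈ K, ∑ i, ⟪(b i : H), x⟫_ℂ • (b i : H) = x := fun x hx => by
    have := congrArg Subtype.val (b.sum_repr' ⟨x, hx⟩)
    simpa using this
  let v : Fin 2 → Fin m → H := fun s i => b (Sum.inl (i, s))
  have hv : ∀ s, Orthonormal ℂ (v s) := fun s =>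
    hb.comp (fun i => Sum.inl (i, s)) fun i j h => by simpa using h
  obtain ⟨T, hTT, hTskew, hFT⟩ := exists_skew_of_orthonormal (hv 0) (hv 1)
    fun i j => hb.2 (by simp)
  let F : H →L[ℂ] H := ∑ i, (InnerProductSpace.rankOne ℂ (v 0 i) (v 0 i) +
    InnerProductSpace.rankOne ℂ (v 1 i) (v 1 i))
  have hF : ∀ x, F x = ∑ i, (⟪v 0 i, x⟫_ℂ • v 0 i + ⟪v 1 i, x⟫_ℂ • v 1 i) := fun x => by simp [F]
  have hTF : ∀ x, T (T x) = -F x := fun x => by rw [hTT, hF]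
  have hFT' : ∀ x, F (T x) = T x := fun x => by rw [hF, hFT]
  refine ⟨T, F, ⟨?_, ?_⟩, fun x => ?_, hTF, hFT', hTskew, fun h x hxK => ?_, fun h => ?_⟩
  · ext x
    rw [mul_apply_eq_comp, ← neg_neg (F x), ← hTF, map_neg, hFT']
  · refine isSelfAdjoint_of_inner fun x y => ?_
    rw [← neg_inj, ← inner_neg_left, ← inner_neg_right, ← hTF, ← hTF, hTskew, ← inner_conj_symm x,
      hTskew (T y), map_neg, inner_conj_symm, ← inner_conj_symm, inner_conj_symm]
  · rw [hF]
    exact Submodule.sum_mem _ fun i _ => add_mem (K.smul_mem _ (hbK _)) (K.smul_mem _ (hbK _))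
  · obtain rfl : r = 0 := hr.symm.trans h
    rw [hF]
    conv_rhs => rw [← hx x hxK]
    simp [Fintype.sum_prod_type, v]
  · obtain rfl : r = 1 := hr.symm.trans h
    refine ⟨b (Sum.inr 0), hbK _, hb.1 _, fun x hxK => ?_⟩
    rw [hF]
    conv_lhs => rw [← hx x hxK]
    simp [Fintype.sum_prod_type, v]

end Quaternionic

/-! ### Algebra of two idempotents -/

section TwoProjections

variable {R : Type*} [Ring R] {P Q E : R}

/-- The bracket is `P Q + (1 - P)(1 - Q)`, so both sides equal `P Q`. -/
theorem mul_eq_of_two_projections (hP : P * P = P) (hQ : Q * Q = Q) :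
    (1 - P - Q + 2 * (P * Q)) * Q = P * (1 - P - Q + 2 * (P * Q)) := by
  have hP' : ∀ x, P * (P * x) = P * x := fun x => by rw [← mul_assoc, hP]
  simp only [two_mul, mul_sub, sub_mul, mul_add, add_mul, mul_one, one_mul, mul_assoc, hP, hP', hQ]
  abel

theorem normSq_of_two_projections (hP : P * P = P) (hQ : Q * Q = Q) :
    (1 - P - Q + 2 * (Q * P)) * (1 - P - Q + 2 * (P * Q)) = (1 - P - Q) * (1 - P - Q) := by
  have hP' : ∀ x, P * (P * x) = P * x := fun x => by rw [← mul_assoc, hP]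
  simp only [two_mul, mul_sub, sub_mul, mul_add, add_mul, mul_one, one_mul, mul_assoc, hP, hP', hQ]
  abel

theorem commute_sq_left_of_two_projections (hP : P * P = P) (hQ : Q * Q = Q) :
    Commute ((1 - P - Q) * (1 - P - Q)) P := by
  have hP' : ∀ x, P * (P * x) = P * x := fun x => by rw [← mul_assoc, hP]
  simp only [Commute, SemiconjBy, mul_sub, sub_mul, mul_one, one_mul, mul_assoc, hP, hP', hQ]
  abel

theorem one_sub_sq_of_two_projections (hP : P * P = P) (hQ : Q * Q = Q) :
    1 - (1 - P - Q) * (1 - P - Q) = (Q - P) * (Q - P) := by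
  simp only [mul_sub, sub_mul, mul_one, one_mul, hP, hQ]
  abel

theorem one_sub_of_two_projections (hP : P * P = P) (hQ : Q * Q = Q) :
    1 - (1 - P - Q + 2 * (P * Q)) = (Q - P) * (Q - P) + (Q - P) * P - P * (Q - P) := by
  simp only [two_mul, mul_sub, sub_mul, hP, hQ]
  abel

theorem mul_mul_eq_zero_of_two_projections (hP : P * P = P) (hE : (1 - P - Q) * E = 0) :
    P * (Q * E) = 0 := by
  have hP' : ∀ x, P * (P * x) = P * x := fun x => by rw [← mul_assoc, hP]
  have h := congrArg (P * ·) hE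
  simp only [sub_mul, mul_sub, one_mul, mul_zero, hP', sub_self, zero_sub, neg_eq_zero] at h
  exact h

theorem mul_eq_zero_of_two_projections (hP : P * P = P) (hE : (1 - P - Q) * E = 0) :
    (1 - P - Q + 2 * (P * Q)) * E = 0 := by
  rw [add_mul, hE, mul_assoc, mul_assoc, mul_mul_eq_zero_of_two_projections hP hE, mul_zero,
    add_zero]

end TwoProjections

section AntiunitarySwap

variable {H : Type*} [NormedAddCommGroup H] [InnerProductSpace ℂ H] {θ : H ≃ₗᵢ⋆[ℂ] H}

theorem antiunitary_apply_swap (hθ : ∀ x, θ (θ x) = -x) {P Q : H →L[ℂ] H}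
    (hθP : ∀ x, θ (P x) = Q (θ x)) (x : H) : θ (Q x) = P (θ x) := by
  have h := hθP (θ x)
  rw [hθ] at h
  have h2 := congrArg θ h
  rw [hθ, map_neg, map_neg, neg_inj] at h2
  exact h2.symm

theorem antiunitary_apply_one_sub_sub (hθ : ∀ x, θ (θ x) = -x) {P Q : H →L[ℂ] H}
    (hθP : ∀ x, θ (P x) = Q (θ x)) (x : H) : θ ((1 - P - Q) x) = (1 - P - Q) (θ x) := by
  simp only [_root_.sub_apply, one_apply_eq_self, map_sub, hθP, antiunitary_apply_swap hθ hθP]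
  abel

end AntiunitarySwap

/-! ### The canonical intertwiner away from the kernel of `1 - P - Q` -/

section PartialIsometry

variable {H : Type*} [NormedAddCommGroup H] [InnerProductSpace ℂ H] [CompleteSpace H]
  {θ : H ≃ₗᵢ⋆[ℂ] H}

theorem apply_zero_of_sq_apply_zero {B : H →L[ℂ] H} (hB : IsSelfAdjoint B) {x : H}
    (h : B (B x) = 0) : B x = 0 := by
  rw [← inner_self_eq_zero (𝕜 := ℂ), inner_apply_of_isSelfAdjoint hB, h, inner_zero_right]

/-- The orthogonal projection onto the kernel of the difference of the identity and the sum of two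
projections whose difference is compact. -/
theorem exists_projection_ker {P Q : H →L[ℂ] H} (hP : IsStarProjection P) (hQ : IsStarProjection Q)
    (hA : IsCompactOperator (Q - P)) :
    ∃ E : H →L[ℂ] H, IsStarProjection E ∧ FiniteDimensional ℂ (LinearMap.range (E : H →ₗ[ℂ] H)) ∧
      (∀ x, E x = x ↔ (1 - P - Q) x = 0) ∧ (1 - P - Q) * E = 0 := by
  let N : Submodule ℂ H := LinearMap.ker ((1 - P - Q : H →L[ℂ] H) : H →ₗ[ℂ] H)
  have hN : IsClosed (N : Set H) := (1 - P - Q : H →L[ℂ] H).isClosed_ker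
  have hAA : IsCompactOperator ((Q - P) * (Q - P) : H →L[ℂ] H) := hA.comp_clm (Q - P)
  have hfin : FiniteDimensional ℂ N := by
    -- On the kernel of `1 - P - Q` the compact operator `(Q - P)²` acts as the identity.
    have := ContinuousLinearMap.finite_dimensional_eigenspace hAA 1 one_ne_zero
    refine Submodule.finiteDimensional_of_le (S₂ := Module.End.eigenspace
      ((Q - P) * (Q - P) : H →L[ℂ] H).toLinearMap 1) fun x hx => ?_
    have hx0 : (1 - P - Q) x = 0 := hx
    rw [Module.End.mem_eigenspace_iff, one_smul, ← one_sub_sq_of_two_projections hP.1 hQ.1]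
    change x - (1 - P - Q) ((1 - P - Q) x) = x
    rw [hx0, map_zero, sub_zero]
  have hc : CompleteSpace N := hN.completeSpace_coe
  refine ⟨N.starProjection, isStarProjection_starProjection, ?_, fun x => ?_, ?_⟩
  · refine Submodule.finiteDimensional_of_le (S₂ := N) ?_
    rintro _ ⟨x, rfl⟩
    exact N.starProjection_apply_mem x
  · exact Submodule.starProjection_eq_self_iff
  · ext x
    exact N.starProjection_apply_mem x

/-- Fredholm alternative for the compact operator `1 - T` at the value `1`. -/
theorem isUnit_of_injective_of_isCompactOperator {T : H →L[ℂ] H} (hT : IsCompactOperator (1 - T : H →L[ℂ] H))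
    (h : ∀ x, T x = 0 → x = 0) : IsUnit T := by
  rcases IsCompactOperator.hasEigenvalue_or_mem_resolventSet hT (one_ne_zero (α := ℂ)) with h1 | h1
  · obtain ⟨x, hx⟩ := h1.exists_hasEigenvector
    refine absurd (h x ?_) hx.2
    have := hx.apply_eq_smul
    simpa using this
  · rw [spectrum.mem_resolventSet_iff, map_one, sub_sub_cancel] at h1
    exact h1

theorem antiunitary_apply_projection_ker (hθ : ∀ x, θ (θ x) = -x) {P Q E : H →L[ℂ] H}
    (hθP : ∀ x, θ (P x) = Q (θ x)) (hE : IsStarProjection E)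
    (hEker : ∀ x, E x = x ↔ (1 - P - Q) x = 0) (x : H) : θ (E x) = E (θ x) := by
  refine apply_antiunitary_of_invariant hθ hE.2 (fun y => ?_) x
  have hEE : E (E y) = E y := congrArg (· y) hE.1.eq
  rw [hEker, ← antiunitary_apply_one_sub_sub hθ hθP, (hEker _).1 hEE, map_zero]

/-- The canonical partial isometry intertwining two projections with compact difference. -/
theorem exists_partialIsometry_intertwining (hθ : ∀ x, θ (θ x) = -x) {P Q E : H →L[ℂ] H}
    (hP : IsStarProjection P) (hQ : IsStarProjection Q) (hA : IsCompactOperator (Q - P))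
    (hθP : ∀ x, θ (P x) = Q (θ x)) (hE : IsStarProjection E)
    (hEfin : FiniteDimensional ℂ (LinearMap.range (E : H →ₗ[ℂ] H)))
    (hEker : ∀ x, E x = x ↔ (1 - P - Q) x = 0) (hBE : (1 - P - Q) * E = 0) :
    ∃ R : H →L[ℂ] H, star R * R = 1 - E ∧ R * star R = 1 - E ∧ R * Q = P * R ∧
      (∀ x, θ (R x) = star R (θ x)) ∧
      ∃ C₀ C₁ C₂, 1 - R = E * C₀ + (Q - P) * C₁ + P * (Q - P) * C₂ := by
  have hθQ := antiunitary_apply_swap hθ hθP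
  have hPP : P * P = P := hP.1
  have hQQ : Q * Q = Q := hQ.1
  have hEE : E * E = E := hE.1
  set B : H →L[ℂ] H := 1 - P - Q with hBdef
  have hB : IsSelfAdjoint B := ((IsSelfAdjoint.one _).sub hP.2).sub hQ.2
  have hBE' : E * B = 0 := by
    have := congrArg star hBE
    rwa [star_mul, hE.2.star_eq, hB.star_eq, star_zero] at this
  have hBcomm : B = 1 - Q - P := by rw [hBdef]; abel
  have hBθ : ∀ x, θ (B x) = B (θ x) := antiunitary_apply_one_sub_sub hθ hθP
  have hEθ : ∀ x, θ (E x) = E (θ x) := antiunitary_apply_projection_ker hθ hθP hE hEker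
  have hQPE : Q * (P * E) = 0 := mul_mul_eq_zero_of_two_projections hQQ (hBcomm ▸ hBE)
  have hEP : Commute E P := by
    have h1 : E * (P * E) = P * E := by
      ext x
      refine (hEker _).2 ?_
      have : B * (P * E) = 0 := by
        rw [hBdef, sub_mul, sub_mul, hQPE, one_mul, ← mul_assoc, hPP, sub_self, sub_zero]
      exact congrArg (· x) this
    have h2 := congrArg star h1
    simp only [star_mul, hE.2.star_eq, hP.2.star_eq] at h2
    rw [Commute, SemiconjBy, ← h2, mul_assoc, h1]
  have hEQ : Commute E Q := by
    have h1 : Q * E = E - P * E := by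
      have := hBE
      rw [hBdef, sub_mul, sub_mul, one_mul, sub_eq_zero] at this
      exact this.symm
    have h2 := congrArg star h1
    simp only [star_sub, star_mul, hE.2.star_eq, hP.2.star_eq, hQ.2.star_eq] at h2
    rw [Commute, SemiconjBy, h1, h2, hEP.eq]
  -- Adding `E` fills in the kernel of `B²`, so `G` is invertible and `G^(-1/2)` can replace the
  -- inverse of `|B|`.
  set G : H →L[ℂ] H := B * B + E with hG
  have hG0 : 0 ≤ G := by
    refine add_nonneg ?_ ?_
    · have := star_mul_self_nonneg B
      rwa [hB.star_eq] at this
    · have := star_mul_self_nonneg E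
      rwa [hE.2.star_eq, hEE] at this
  have hGcompact : IsCompactOperator (1 - G : H →L[ℂ] H) := by
    have h1 : 1 - G = (Q - P) * (Q - P) - E := by
      rw [hG, ← sub_sub, one_sub_sq_of_two_projections hPP hQQ]
    rw [h1]
    exact (hA.comp_clm (Q - P)).sub (isCompactOperator_of_finiteDimensional_range E)
  have hEG : E * G = E := by rw [hG, mul_add, ← mul_assoc, hBE', zero_mul, zero_add, hEE]
  have hGunit : IsUnit G := by
    refine isUnit_of_injective_of_isCompactOperator hGcompact fun x hx => ?_
    have hEx : E x = 0 := by
      conv_lhs => rw [← hEG]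
      rw [mul_apply_eq_comp, hx, map_zero]
    have hBBx : B (B x) = 0 := by
      have : B (B x) + E x = 0 := hx
      rwa [hEx, add_zero] at this
    rw [← (hEker x).2 (apply_zero_of_sq_apply_zero hB hBBx), hEx]
  have hGP : Commute G P := (commute_sq_left_of_two_projections hPP hQQ).add_left hEP
  have hGQ : Commute G Q := by
    refine Commute.add_left ?_ hEQ
    rw [hBcomm]
    exact commute_sq_left_of_two_projections hQQ hPP
  have hGE : Commute G E := by
    have := congrArg star hEG
    rw [star_mul, hE.2.star_eq, hG0.isSelfAdjoint.star_eq] at this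
    rw [Commute, SemiconjBy, hEG, this]
  have hGθ : ∀ x, θ (G x) = G (θ x) := fun x => by
    rw [hG]
    simp only [_root_.add_apply, mul_apply_eq_comp, map_add, hBθ, hEθ]
  obtain ⟨s, hs⟩ := (CFC.isUnit_sqrt_iff G hG0).2 hGunit
  have hs0 : (0 : H →L[ℂ] H) ≤ s := hs ▸ CFC.sqrt_nonneg G
  have hss : (s : H →L[ℂ] H) * s = G := by rw [hs]; exact CFC.sqrt_mul_sqrt_self G hG0
  have hsP : Commute (s : H →L[ℂ] H) P := hs ▸ commute_sqrt hGP
  have hsQ : Commute (s : H →L[ℂ] H) Q := hs ▸ commute_sqrt hGQ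
  have hsE : Commute (s : H →L[ℂ] H) E := hs ▸ commute_sqrt hGE
  have hsθ : ∀ x, θ ((s : H →L[ℂ] H) x) = (s : H →L[ℂ] H) (θ x) := fun x => by
    rw [hs]; exact antiunitary_apply_sqrt hG0 hGθ x
  set Z : H →L[ℂ] H := ((s⁻¹ : (H →L[ℂ] H)ˣ) : H →L[ℂ] H)
  have hsZ : (s : H →L[ℂ] H) * Z = 1 := s.mul_inv
  have hZs : Z * (s : H →L[ℂ] H) = 1 := s.inv_mul
  have hZP : Commute Z P := hsP.units_inv_left
  have hZQ : Commute Z Q := hsQ.units_inv_left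
  have hZsa : star Z = Z := by
    have h1 : star Z * s = 1 := by
      have := congrArg star hsZ
      rwa [star_mul, hs0.isSelfAdjoint.star_eq, star_one] at this
    calc star Z = star Z * (s * Z) := by rw [hsZ, mul_one]
      _ = Z := by rw [← mul_assoc, h1, one_mul]
  have hZθ : ∀ x, θ (Z x) = Z (θ x) := fun x => by
    have h1 : (s : H →L[ℂ] H) (Z x) = x := by rw [← mul_apply_eq_comp, hsZ]; rfl
    have h2 : Z ((s : H →L[ℂ] H) (θ (Z x))) = θ (Z x) := by rw [← mul_apply_eq_comp, hZs]; rfl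
    rw [← h2, ← hsθ, h1]
  have hZGZ : Z * G * Z = 1 := by
    rw [← hss, ← mul_assoc, hZs, one_mul, hsZ]
  have hZEZ : Z * E * Z = E := by
    have h1 : s * (Z * E * Z) * s = s * E * s := by
      rw [hsE.eq, mul_assoc E, hss, hEG, ← mul_assoc, ← mul_assoc, hsZ, one_mul, mul_assoc, hZs,
        mul_one]
    have h2 := congrArg (fun y => Z * y * Z) h1
    simpa only [mul_assoc, hsZ, mul_one, ← mul_assoc Z (s : H →L[ℂ] H), hZs, one_mul] using h2
  have hZBBZ : Z * (B * B) * Z = 1 - E := by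
    have h1 : B * B = G - E := by rw [hG, add_sub_cancel_right]
    rw [h1, mul_sub, sub_mul, hZGZ, hZEZ]
  -- Since `X* X = X X* = B²`, the operator `X Z` with `Z = G^(-1/2)` is the phase of `X`, and it
  -- vanishes on the range of `E`.
  set X : H →L[ℂ] H := 1 - P - Q + 2 * (P * Q) with hX
  have hXstar : star X = 1 - P - Q + 2 * (Q * P) := by
    rw [hX, two_mul, two_mul]
    simp only [star_sub, star_add, star_mul, star_one, hP.2.star_eq, hQ.2.star_eq]
  have hXX : star X * X = B * B := by
    rw [hXstar]; exact normSq_of_two_projections hPP hQQ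
  have hXX' : X * star X = B * B := by
    rw [hXstar, hBcomm, hX, sub_right_comm]
    exact normSq_of_two_projections hQQ hPP
  have hZX : Commute Z X := by
    rw [hX, two_mul]
    exact (((Commute.one_right _).sub_right hZP).sub_right hZQ).add_right
      ((hZP.mul_right hZQ).add_right (hZP.mul_right hZQ))
  have hRstar : star (X * Z) = star X * Z := by
    rw [← hZX.eq, star_mul, hZsa]
  refine ⟨X * Z, ?_, ?_, ?_, fun x => ?_, ?_⟩
  · rw [star_mul, hZsa, mul_assoc, ← mul_assoc (star X), hXX, ← mul_assoc, hZBBZ]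
  · rw [hRstar, ← hZX.eq, mul_assoc, ← mul_assoc X, hXX', ← mul_assoc, hZBBZ]
  · rw [mul_assoc, hZQ.eq, ← mul_assoc, mul_eq_of_two_projections hPP hQQ, mul_assoc]
  · rw [hRstar, mul_apply_eq_comp, mul_apply_eq_comp, ← hZθ, hXstar, hX, two_mul, two_mul]
    simp only [_root_.sub_apply, _root_.add_apply, one_apply_eq_self, mul_apply_eq_comp, map_sub,
      map_add, hθP, hθQ]
    abel
  -- From `(s - 1)(s + 1) = G - 1 = E - (Q - P)²`, dividing by `s + 1 ≥ 1` exhibits `s - 1` with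
  -- explicit factors `E` and `Q - P`.
  · obtain ⟨y, hy⟩ : IsUnit ((s : H →L[ℂ] H) + 1) :=
      CStarAlgebra.isUnit_of_le 1 (le_add_of_nonneg_left hs0)
        (isUnit_one.isStrictlyPositive zero_le_one)
    set Y : H →L[ℂ] H := ((y⁻¹ : (H →L[ℂ] H)ˣ) : H →L[ℂ] H)
    have h1 : ((s : H →L[ℂ] H) + 1) * Y = 1 := by rw [← hy]; exact y.mul_inv
    have h2 : (s : H →L[ℂ] H) - 1 = (E - (Q - P) * (Q - P)) * Y := by
      have h3 : ((s : H →L[ℂ] H) - 1) * (s + 1) = E - (Q - P) * (Q - P) := by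
        rw [← one_sub_sq_of_two_projections hPP hQQ, sub_mul, mul_add, mul_add, hss, hG]
        simp only [mul_one, one_mul]
        abel
      rw [← h3, mul_assoc, h1, mul_one]
    have h4 : 1 - X = (Q - P) * (Q - P) + (Q - P) * P - P * (Q - P) :=
      one_sub_of_two_projections hPP hQQ
    refine ⟨Y * Z, (Q - P + P - (Q - P) * Y) * Z, -Z, ?_⟩
    calc 1 - X * Z = ((s - 1) + (1 - X)) * Z := by rw [sub_add_sub_cancel, sub_mul, hsZ]
      _ = _ := by
        rw [h2, h4]
        noncomm_ring

end PartialIsometry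

/-! ### The symmetric unitary intertwiner and its parity obstruction -/

section Decoupling

variable {H : Type*} [NormedAddCommGroup H] [InnerProductSpace ℂ H] [CompleteSpace H]
  {θ : H ≃ₗᵢ⋆[ℂ] H}

theorem mul_projection_eq_zero {R E : H →L[ℂ] H} (hE : IsStarProjection E)
    (hR : star R * R = 1 - E) : R * E = 0 := by
  rw [← CStarRing.star_mul_self_eq_zero_iff, star_mul, mul_assoc, ← mul_assoc (star R), hR, sub_mul,
    one_mul, hE.1.eq, sub_self, mul_zero]

theorem projection_mul_eq_zero {R E : H →L[ℂ] H} (hE : IsStarProjection E)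
    (hR : R * star R = 1 - E) : E * R = 0 := by
  rw [← CStarRing.mul_star_self_eq_zero_iff, star_mul, mul_assoc, ← mul_assoc R, hR, sub_mul,
    one_mul, hE.2.star_eq, hE.1.eq, sub_self, mul_zero]

/-- Two projections with compact difference, exchanged by an antiunitary operator of square `-1`,
are intertwined by a symmetric unitary which is close to the identity, exactly in the even case, and
up to one exchanged pair of vectors in the odd case. -/
theorem exists_decoupling (hθ : ∀ x, θ (θ x) = -x) {P Q : H →L[ℂ] H}
    (hP : IsStarProjection P) (hQ : IsStarProjection Q) (hA : IsCompactOperator (Q - P))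
    (hθP : ∀ x, θ (P x) = Q (θ x)) :
    ∃ V ∈ unitary (H →L[ℂ] H), (∀ x, θ (V x) = star V (θ x)) ∧
      (∃ E C₀ C₁ C₂ : H →L[ℂ] H, FiniteDimensional ℂ (LinearMap.range (E : H →ₗ[ℂ] H)) ∧
        1 - V = E * C₀ + (Q - P) * C₁ + P * (Q - P) * C₂) ∧
      (Module.finrank ℂ (LinearMap.ker ((Q - P - 1 : H →L[ℂ] H) : H →ₗ[ℂ] H)) % 2 = 0 →
        V * Q = P * V) ∧
      (Module.finrank ℂ (LinearMap.ker ((Q - P - 1 : H →L[ℂ] H) : H →ₗ[ℂ] H)) % 2 = 1 →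
        ∃ f, ‖f‖ = 1 ∧ P f = 0 ∧ P (θ f) = θ f ∧ V f = f ∧ V (θ f) = θ f ∧
          ∀ x, V (Q x) - P (V x) = ⟪f, x⟫_ℂ • f - ⟪θ f, x⟫_ℂ • θ f) := by
  obtain ⟨E, hE, hEfin, hEker, hBE⟩ := exists_projection_ker hP hQ hA
  obtain ⟨R, hR1, hR2, hRQ, hRθ, C₀, C₁, C₂, hC⟩ :=
    exists_partialIsometry_intertwining hθ hP hQ hA hθP hE hEfin hEker hBE
  have hθQ := antiunitary_apply_swap hθ hθP
  have hEθ := antiunitary_apply_projection_ker hθ hθP hE hEker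
  set K := LinearMap.ker ((Q - P - 1 : H →L[ℂ] H) : H →ₗ[ℂ] H)
  -- If `A x = x`, then `B² x = x - A² x = 0`, hence `B x = 0`; adding `B x = 0` and `A x - x = 0`
  -- leaves `P x = 0`.
  have hmemK : ∀ x, x ∈ K ↔ P x = 0 ∧ Q x = x := fun x => by
    have hx : x ∈ K ↔ Q x - P x - x = 0 := Iff.rfl
    refine ⟨fun h => ?_, fun h => by rw [hx, h.1, h.2, sub_zero, sub_self]⟩
    rw [hx] at h
    have hAx : (Q - P) x = x := sub_eq_zero.1 h
    have h1 : x - (1 - P - Q) ((1 - P - Q) x) = (Q - P) ((Q - P) x) :=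
      congrArg (· x) (one_sub_sq_of_two_projections hP.1.eq hQ.1.eq)
    rw [hAx, hAx, sub_eq_self] at h1
    have h2 : x - P x - Q x = 0 :=
      apply_zero_of_sq_apply_zero (((IsSelfAdjoint.one _).sub hP.2).sub hQ.2) h1
    have h3 : (2 : ℂ) • P x = 0 := by
      rw [two_smul, ← neg_eq_zero, ← add_zero (0 : H)]
      nth_rewrite 1 [← h]
      rw [← h2]
      abel
    have h4 : P x = 0 := (smul_eq_zero.1 h3).resolve_left two_ne_zero
    rw [h4, sub_zero, sub_eq_zero] at h
    exact ⟨h4, h⟩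
  have hKE : ∀ x ∈ K, E x = x := fun x hx => by
    obtain ⟨h1, h2⟩ := (hmemK x).1 hx
    rw [hEker]
    change x - P x - Q x = 0
    rw [h1, h2, sub_zero, sub_self]
  have hKfin : FiniteDimensional ℂ K :=
    Submodule.finiteDimensional_of_le (S₂ := LinearMap.range (E : H →ₗ[ℂ] H))
      fun x hx => ⟨x, hKE x hx⟩
  obtain ⟨T, F, hF, hFK, hTT, hFT, hTskew, heven, hodd⟩ := exists_quaternionic_structure K
  have hFF : F * F = F := hF.1
  have hPF : P * F = 0 := ContinuousLinearMap.ext fun x => ((hmemK _).1 (hFK x)).1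
  have hQF : Q * F = F := ContinuousLinearMap.ext fun x => ((hmemK _).1 (hFK x)).2
  have hEF : E * F = F := ContinuousLinearMap.ext fun x => hKE _ (hFK x)
  have hFP : F * P = 0 := by
    have := congrArg star hPF
    rwa [star_mul, hP.2.star_eq, hF.2.star_eq, star_zero] at this
  have hFQ : F * Q = F := by
    have := congrArg star hQF
    rwa [star_mul, hQ.2.star_eq, hF.2.star_eq] at this
  have hFE : F * E = F := by
    have := congrArg star hEF
    rwa [star_mul, hE.2.star_eq, hF.2.star_eq] at this
  -- `θ` carries `K`, inside the range of `Q`, into the range of `P`, which `F` annihilates.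
  have hFθF : ∀ x, F (θ (F x)) = 0 := fun x => by
    have h1 : Q (F x) = F x := ((hmemK _).1 (hFK x)).2
    rw [← h1, hθQ, ← mul_apply_eq_comp, hFP]
    rfl
  have hTF : ∀ x, T (F x) = T x := fun x => by
    rw [← neg_inj, ← map_neg, ← hTT, hTT (T x), hFT]
  have hFθT : ∀ x, F (θ (T x)) = 0 := fun x => by rw [← hFT, hFθF]
  have hTθT : ∀ x, T (θ (T x)) = 0 := fun x => by rw [← hTF, hFθT, map_zero]
  have hTθF : ∀ x, T (θ (F x)) = 0 := fun x => by rw [← hTF, hFθF, map_zero]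
  -- the conjugate projection
  set F' : H →L[ℂ] H := antiunitaryConj θ F with hF'
  have hF'_apply : ∀ x, F' x = -θ (F (θ x)) := fun x => by
    rw [hF', antiunitaryConj_apply, antiunitary_symm_apply hθ, map_neg, map_neg]
  have hF'F' : F' * F' = F' := by rw [hF', ← antiunitaryConj_mul, hFF]
  have hF'sa : star F' = F' := by rw [hF', ← antiunitaryConj_star, hF.2.star_eq]
  have hFF' : F * F' = 0 := by
    ext x
    rw [mul_apply_eq_comp, hF'_apply, map_neg, hFθF, neg_zero]
    rfl
  have hF'F : F' * F = 0 := by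
    have := congrArg star hFF'
    rwa [star_mul, hF'sa, hF.2.star_eq, star_zero] at this
  have hPF' : P * F' = F' := by
    ext x
    rw [mul_apply_eq_comp, hF'_apply, map_neg, ← hθQ, ← mul_apply_eq_comp Q, hQF]
  have hEF' : E * F' = F' := by
    ext x
    rw [mul_apply_eq_comp, hF'_apply, map_neg, ← hEθ, ← mul_apply_eq_comp E, hEF]
  have hF'E : F' * E = F' := by
    have := congrArg star hEF'
    rwa [star_mul, hE.2.star_eq, hF'sa] at this
  have hF'Q : F' * Q = 0 := by
    ext x
    rw [mul_apply_eq_comp, hF'_apply, hθQ, ← mul_apply_eq_comp F, hFP, _root_.zero_apply, map_zero,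
      neg_zero, _root_.zero_apply]
  -- the exchange of the two finite-dimensional subspaces
  let θL : H →L⋆[ℂ] H := ((θ : H ≃SL[starRingEnd ℂ] H) : H →SL[starRingEnd ℂ] H)
  -- A product of two antilinear maps is linear. The symmetrized product is self-adjoint and
  -- commutes with `θ`, so it meets the symmetry required of `V`; it swaps the ranges of `F` and
  -- `F'`.
  obtain ⟨J, hJ⟩ : ∃ J : H →L[ℂ] H, ∀ x, J x = -(θ (T x) + T (θ x)) :=
    ⟨-(θL.comp T + T.comp θL), fun x => rfl⟩
  have hJsa : IsSelfAdjoint J := isSelfAdjoint_of_inner fun x y => by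
    have h1 : ⟪x, T (θ y)⟫_ℂ = -⟪θ y, T x⟫_ℂ := by
      rw [← inner_conj_symm, hTskew, map_neg, inner_conj_symm]
    have h2 : ⟪x, θ (T y)⟫_ℂ = -⟪T y, θ x⟫_ℂ := by
      rw [← inner_conj_symm, inner_antiunitary_left hθ, map_neg, inner_conj_symm]
    rw [hJ, hJ, inner_neg_left, inner_neg_right, inner_add_left, inner_add_right, h1, h2,
      inner_antiunitary_left hθ, hTskew, add_comm]
  have hJθ : ∀ x, θ (J x) = J (θ x) := fun x => by
    simp only [hJ, map_neg, map_add, hθ]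
    abel
  have hJF : J * F = F' * J := by
    ext x
    simp only [mul_apply_eq_comp, hJ, hF'_apply, hTF, hTθF, map_neg, map_add, hθ, hFT, hFθT]
    simp
  have hFJ : F * J = J * F' := by
    have := congrArg star hJF
    rwa [star_mul, star_mul, hJsa.star_eq, hF.2.star_eq, hF'sa] at this
  have hFF'J : (F + F') * J = J := by
    ext x
    rw [add_mul, ← hJF]
    simp only [mul_apply_eq_comp, _root_.add_apply, hJ, hTF, hTθF, map_neg, map_add, hFT, hFθT]
    abel
  have hJFF' : J * (F + F') = J := by
    rw [mul_add, hJF, ← hFJ, ← add_mul, add_comm, hFF'J]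
  have hJJ : J * J = F + F' := by
    ext x
    simp only [mul_apply_eq_comp, _root_.add_apply, hF'_apply, hJ, map_neg, map_add, hθ, hTθT, hTT]
    simp
  have hJE : J * E = J := by
    rw [← hJFF', mul_assoc, add_mul, hFE, hF'E]
  have hEJ : E * J = J := by
    rw [← hFF'J, ← mul_assoc, mul_add, hEF, hEF']
  have hJQ : J * Q = P * J := by
    calc J * Q = J * (F + F') * Q := by rw [hJFF']
      _ = J * F := by rw [mul_assoc, add_mul, hFQ, hF'Q, add_zero]
      _ = P * ((F + F') * J) := by
        rw [← mul_assoc, mul_add, hPF, hPF', zero_add, hJF]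
      _ = P * J := by rw [hFF'J]
  -- the remaining projection
  set D : H →L[ℂ] H := E - (F + F') with hD
  have hDsa : star D = D := by
    rw [hD, star_sub, star_add, hE.2.star_eq, hF.2.star_eq, hF'sa]
  have hDθ : ∀ x, θ (D x) = D (θ x) := fun x => by
    simp only [hD, _root_.sub_apply, _root_.add_apply, map_sub, map_add, hEθ, hF'_apply, map_neg,
      hθ]
    abel
  have hED : E * D = D := by rw [hD, mul_sub, mul_add, hE.1.eq, hEF, hEF']
  have hDE : D * E = D := by rw [hD, sub_mul, add_mul, hE.1.eq, hFE, hF'E]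
  have hJD : J * D = 0 := by rw [hD, mul_sub, hJE, hJFF', sub_self]
  have hDJ : D * J = 0 := by rw [hD, sub_mul, hEJ, hFF'J, sub_self]
  have hDD : D * D = D := by
    nth_rewrite 1 [hD]
    rw [sub_mul, hED, sub_eq_self, hD, mul_sub, add_mul, hFE, hF'E, mul_add, add_mul, add_mul, hFF,
      hF'F, hFF', hF'F', add_zero, zero_add, sub_self]
  have hVQ : ∀ x, (R + J + D) (Q x) - P ((R + J + D) x) = D (Q x) - P (D x) := fun x => by
    have h1 : R (Q x) = P (R x) := congrArg (· x) hRQ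
    have h2 : J (Q x) = P (J x) := congrArg (· x) hJQ
    simp only [_root_.add_apply, map_add, h1, h2]
    abel
  have hQEK : ∀ x, Q (E x) ∈ K := fun x => (hmemK _).2
    ⟨congrArg (· x) (mul_mul_eq_zero_of_two_projections hP.1.eq hBE), congrArg (· (E x)) hQ.1.eq⟩
  have hFQE : ∀ x, F (Q (E x)) = F x := fun x => by
    rw [← mul_apply_eq_comp F, hFQ, ← mul_apply_eq_comp F, hFE]
  -- On the range of `E` one has `1 = P + Q`, and `θ` exchanges the two parts. So `D` is the defect
  -- `Q E - F` on `K` plus its conjugate by `θ`: zero in the even case, of rank two in the odd one.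
  have hDx : ∀ x, D x = (Q (E x) - F x) - θ (Q (E (θ x)) - F (θ x)) := fun x => by
    have h1 : E x - P (E x) - Q (E x) = 0 := congrArg (· x) hBE
    rw [map_sub, hθQ, hEθ, hθ, map_neg, map_neg, hD, _root_.sub_apply, _root_.add_apply, hF'_apply]
    linear_combination (norm := module) h1
  have hRE := mul_projection_eq_zero hE hR1
  have hER := projection_mul_eq_zero hE hR2
  have hREs : star R * E = 0 := by
    have := congrArg star hER
    rwa [star_mul, hE.2.star_eq, star_zero] at this
  have hERs : E * star R = 0 := by
    have := congrArg star hRE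
    rwa [star_mul, hE.2.star_eq, star_zero] at this
  have hRX : ∀ Y, E * Y = Y → R * Y = 0 := fun Y hY => by
    rw [← hY, ← mul_assoc, hRE, zero_mul]
  have hRsX : ∀ Y, E * Y = Y → star R * Y = 0 := fun Y hY => by
    rw [← hY, ← mul_assoc, hREs, zero_mul]
  have hXR : ∀ Y, Y * E = Y → Y * R = 0 := fun Y hY => by
    rw [← hY, mul_assoc, hER, mul_zero]
  have hXRs : ∀ Y, Y * E = Y → Y * star R = 0 := fun Y hY => by
    rw [← hY, mul_assoc, hERs, mul_zero]
  have hVs : star (R + J + D) = star R + J + D := by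
    rw [star_add, star_add, hJsa.star_eq, hDsa]
  have hVD : (R + J + D) * D = D := by
    rw [add_mul, add_mul, hRX D hED, hJD, hDD, zero_add, zero_add]
  refine ⟨R + J + D, ?_, fun x => ?_, ?_, fun h => ?_, fun h => ?_⟩
  · rw [Unitary.mem_iff, hVs]
    simp only [add_mul, mul_add, hR1, hR2, hJJ, hDD, hJD, hDJ, hRX _ hEJ, hRX _ hED, hRsX _ hEJ,
      hRsX _ hED, hXR _ hJE, hXR _ hDE, hXRs _ hJE, hXRs _ hDE]
    constructor <;> (rw [hD]; abel)
  · rw [hVs]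
    simp only [_root_.add_apply, map_add, hRθ, hJθ, hDθ]
  · refine ⟨E, C₀ - J - D, C₁, C₂, hEfin, ?_⟩
    rw [← sub_sub, ← sub_sub, hC, mul_sub E, mul_sub E, hEJ, hED]
    abel
  · have hD0 : ∀ x, D x = 0 := fun x => by
      rw [hDx, ← hFQE, heven h _ (hQEK x), sub_self, ← hFQE, heven h _ (hQEK _), sub_self, map_zero,
        sub_zero]
    ext x
    have := hVQ x
    rw [hD0, hD0, map_zero, sub_zero, sub_eq_zero] at this
    exact this
  · obtain ⟨f, hfK, hf1, hf⟩ := hodd h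
    obtain ⟨hPf, hQf⟩ := (hmemK f).1 hfK
    have hPθf : P (θ f) = θ f := by rw [← hθQ, hQf]
    have hQθf : Q (θ f) = 0 := by rw [← hθP, hPf, map_zero]
    have hδ : ∀ x, Q (E x) - F x = ⟪f, x⟫_ℂ • f := fun x => by
      nth_rewrite 1 [hf _ (hQEK x)]
      rw [hFQE, add_sub_cancel_left, ← inner_apply_of_isSelfAdjoint hQ.2, hQf,
        ← inner_apply_of_isSelfAdjoint hE.2, hKE f hfK]
    have hDx' : ∀ x, D x = ⟪f, x⟫_ℂ • f + ⟪θ f, x⟫_ℂ • θ f := fun x => by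
      rw [hDx, hδ, hδ, map_smulₛₗ, inner_conj_symm, inner_antiunitary_left hθ, neg_smul,
        sub_neg_eq_add]
    have hff : ⟪f, f⟫_ℂ = 1 := by rw [inner_self_eq_norm_sq_to_K, hf1]; simp
    have hDf : D f = f := by
      rw [hDx', hff, inner_antiunitary_self hθ, one_smul, zero_smul, add_zero]
    have hDθf : D (θ f) = θ f := by rw [← hDθ, hDf]
    have hV : ∀ x, D x = x → (R + J + D) x = x := fun x hx => by
      conv_lhs => rw [← hx, ← mul_apply_eq_comp, hVD]
      exact hx
    refine ⟨f, hf1, hPf, hPθf, hV _ hDf, hV _ hDθf, fun x => ?_⟩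
    rw [hVQ, hDx', hDx', ← inner_apply_of_isSelfAdjoint hQ.2, hQf,
      ← inner_apply_of_isSelfAdjoint hQ.2, hQθf, inner_zero_left, zero_smul, add_zero, map_add,
      map_smul, map_smul, hPf, hPθf, smul_zero, zero_add]

end Decoupling

/-! ### From a rank-two commutator to a pair of shifts -/

section ShiftStructure

variable {H : Type*} [NormedAddCommGroup H] [InnerProductSpace ℂ H] [CompleteSpace H]

theorem unitary_zpow_add_apply (W : unitary (H →L[ℂ] H)) (m n : ℤ) (x : H) :
    ((W ^ (m + n) : unitary (H →L[ℂ] H)) : H →L[ℂ] H) x =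
      ((W ^ m : unitary (H →L[ℂ] H)) : H →L[ℂ] H)
        (((W ^ n : unitary (H →L[ℂ] H)) : H →L[ℂ] H) x) := by
  rw [zpow_add, Submonoid.coe_mul, mul_apply_eq_comp]

theorem unitary_zpow_zero_apply (W : unitary (H →L[ℂ] H)) (x : H) :
    ((W ^ (0 : ℤ) : unitary (H →L[ℂ] H)) : H →L[ℂ] H) x = x := by
  rw [zpow_zero]; rfl

theorem unitary_apply_zpow_apply (W : unitary (H →L[ℂ] H)) (n : ℤ) (x : H) :
    (W : H →L[ℂ] H) (((W ^ n : unitary (H →L[ℂ] H)) : H →L[ℂ] H) x) =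
      ((W ^ (n + 1) : unitary (H →L[ℂ] H)) : H →L[ℂ] H) x := by
  rw [add_comm, unitary_zpow_add_apply, zpow_one]

theorem inner_zpow_apply (W : unitary (H →L[ℂ] H)) (m n : ℤ) (x y : H) :
    ⟪((W ^ m : unitary (H →L[ℂ] H)) : H →L[ℂ] H) x,
      ((W ^ n : unitary (H →L[ℂ] H)) : H →L[ℂ] H) y⟫_ℂ =
      ⟪x, ((W ^ (n - m) : unitary (H →L[ℂ] H)) : H →L[ℂ] H) y⟫_ℂ := by
  rw [← ContinuousLinearMap.inner_map_map_of_mem_unitary (W ^ m).2 x, ← unitary_zpow_add_apply,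
    add_sub_cancel]

theorem antiunitary_apply_zpow {τ : H ≃ₗᵢ⋆[ℂ] H} {W : unitary (H →L[ℂ] H)}
    (hW : ∀ x, τ ((W : H →L[ℂ] H) x) = star (W : H →L[ℂ] H) (τ x)) (n : ℤ) (x : H) :
    τ (((W ^ n : unitary (H →L[ℂ] H)) : H →L[ℂ] H) x) =
      ((W ^ (-n) : unitary (H →L[ℂ] H)) : H →L[ℂ] H) (τ x) := by
  have h1 : ∀ x, τ ((W : H →L[ℂ] H) x) =
      ((W ^ (-1 : ℤ) : unitary (H →L[ℂ] H)) : H →L[ℂ] H) (τ x) := fun x => by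
    rw [hW, zpow_neg_one]; rfl
  induction n using Int.induction_on with
  | zero => simp
  | succ n ih => rw [← unitary_apply_zpow_apply, h1, ih, ← unitary_zpow_add_apply, neg_add_rev]
  | pred n ih =>
    have h2 := h1 (((W ^ (-(n : ℤ) - 1) : unitary (H →L[ℂ] H)) : H →L[ℂ] H) x)
    rw [unitary_apply_zpow_apply, sub_add_cancel, ih] at h2
    have h3 := congrArg (W : H →L[ℂ] H) h2
    rw [unitary_apply_zpow_apply, unitary_apply_zpow_apply, neg_add_cancel, unitary_zpow_zero_apply]
      at h3
    rw [← h3]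
    congr 4
    ring

/-- `W ^ n τ` is again antiunitary of square `-1`, so Kramers orthogonality applies to it. -/
theorem inner_zpow_antiunitary_apply {τ : H ≃ₗᵢ⋆[ℂ] H} (hτ : ∀ x, τ (τ x) = -x)
    {W : unitary (H →L[ℂ] H)}
    (hW : ∀ x, τ ((W : H →L[ℂ] H) x) = star (W : H →L[ℂ] H) (τ x)) (n : ℤ) (x : H) :
    ⟪x, ((W ^ n : unitary (H →L[ℂ] H)) : H →L[ℂ] H) (τ x)⟫_ℂ = 0 := by
  have h := inner_antiunitary_self (θ := τ.trans (Unitary.linearIsometryEquiv (W ^ n)))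
    (fun y => ?_) x
  · rw [← inner_conj_symm]
    exact (congrArg _ h).trans (map_zero _)
  · change ((W ^ n : unitary (H →L[ℂ] H)) : H →L[ℂ] H)
      (τ (((W ^ n : unitary (H →L[ℂ] H)) : H →L[ℂ] H) (τ y))) = -y
    rw [antiunitary_apply_zpow hW, hτ, ← unitary_zpow_add_apply, add_neg_cancel,
      unitary_zpow_zero_apply]

/-- The wandering vectors of a symmetric unitary `W` whose commutator with a symmetric projection
is concentrated on a Kramers pair of vectors generate a pair of opposite shifts. -/
theorem exists_oppositeShifts {τ : H ≃ₗᵢ⋆[ℂ] H} (hτ : ∀ x, τ (τ x) = -x)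
    {W : unitary (H →L[ℂ] H)}
    (hW : ∀ x, τ ((W : H →L[ℂ] H) x) = star (W : H →L[ℂ] H) (τ x))
    {P : H →L[ℂ] H} (hP : IsStarProjection P) (hτP : ∀ x, τ (P x) = P (τ x)) {u : H} (hu : ‖u‖ = 1)
    (hPu : P u = u) (hPWu : P ((W : H →L[ℂ] H) (τ u)) = 0)
    (hWP : ∀ x, (W : H →L[ℂ] H) (P x) - P ((W : H →L[ℂ] H) x) =
      ⟪τ u, x⟫_ℂ • (W : H →L[ℂ] H) (τ u) - ⟪u, (W : H →L[ℂ] H) x⟫_ℂ • u) :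
    ∃ (K : Submodule ℂ H) (e : SpinChain ≃ₗᵢ[ℂ] K), IsClosed (K : Set H) ∧
      (∀ f : SpinChain, (W : H →L[ℂ] H) (e f) =
        e ((oppositeShifts : SpinChain →L[ℂ] SpinChain) f)) ∧
      (∀ x ∈ Kᗮ, (W : H →L[ℂ] H) x ∈ Kᗮ) ∧ (∀ x ∈ K, P x ∈ K) ∧ (∀ x ∈ Kᗮ, P x ∈ Kᗮ) ∧
      (∀ x ∈ Kᗮ, (W : H →L[ℂ] H) (P x) = P ((W : H →L[ℂ] H) x)) := by
  have huu : ⟪u, u⟫_ℂ = 1 := by rw [inner_self_eq_norm_sq_to_K, hu]; simp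
  have hu0 : u ≠ 0 := by rintro rfl; simp at hu
  let Wp : ℤ → H →L[ℂ] H := fun n => ((W ^ n : unitary (H →L[ℂ] H)) : H →L[ℂ] H)
  have hWp : ∀ n x, (W : H →L[ℂ] H) (Wp n x) = Wp (n + 1) x := unitary_apply_zpow_apply W
  have hWp0 : ∀ x, Wp 0 x = x := unitary_zpow_zero_apply W
  have hWpτ : ∀ n x, τ (Wp n x) = Wp (-n) (τ x) := antiunitary_apply_zpow hW
  have hWpinner : ∀ m n x y, ⟪Wp m x, Wp n y⟫_ℂ = ⟪x, Wp (n - m) y⟫_ℂ := inner_zpow_apply W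
  have hτinner : ∀ n, ⟪u, Wp n (τ u)⟫_ℂ = 0 := fun n => inner_zpow_antiunitary_apply hτ hW n u
  have hτinner' : ∀ n, ⟪τ u, Wp n u⟫_ℂ = 0 := fun n => by
    have := hWpinner n 0 u (τ u)
    rw [hτinner, hWp0] at this
    rw [← inner_conj_symm, this, map_zero]
  -- For `x` in the range of `P` the commutator is `(1 - P) W x`; applying `P` kills it and isolates
  -- the coefficient of `u`.
  have hWran : ∀ x, P x = x → ⟪u, (W : H →L[ℂ] H) x⟫_ℂ = 0 := fun x hx => by
    have h := congrArg P (hWP x)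
    have hPP : P (P ((W : H →L[ℂ] H) x)) = P ((W : H →L[ℂ] H) x) := congrArg (· ((W : H →L[ℂ] H) x)) hP.1.eq
    rw [map_sub, map_sub, map_smul, map_smul, hPWu, hPu, hPP, hx, sub_self, smul_zero, zero_sub,
      zero_eq_neg] at h
    exact (smul_eq_zero.1 h).resolve_right hu0
  have hPpos : ∀ n : ℕ, P (Wp n u) = Wp n u := fun n => by
    induction n with
    | zero => rw [Nat.cast_zero, hWp0, hPu]
    | succ n ih =>
      have h := hWP (Wp n u)
      rw [ih, hτinner', hWran _ ih, zero_smul, zero_smul, sub_zero, sub_eq_zero, hWp] at h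
      rw [Nat.cast_succ, ← h]
  have horth_pos : ∀ n : ℕ, ⟪u, Wp (n + 1) u⟫_ℂ = 0 := fun n => by
    rw [← hWp, hWran _ (hPpos n)]
  have horth : ∀ n : ℤ, n ≠ 0 → ⟪u, Wp n u⟫_ℂ = 0 := fun n hn => by
    rcases lt_or_gt_of_ne hn with h | h
    · have h1 := hWpinner n 0 u u
      obtain ⟨m, hm⟩ : ∃ m : ℕ, 0 - n = m + 1 := ⟨(-n - 1).toNat, by omega⟩
      rw [hm, horth_pos, hWp0] at h1
      rw [← inner_conj_symm, h1, map_zero]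
    · obtain ⟨m, rfl⟩ : ∃ m : ℕ, n = m + 1 := ⟨(n - 1).toNat, by omega⟩
      exact horth_pos m
  have hWinj : ∀ x, (W : H →L[ℂ] H) x = 0 → x = 0 := fun x h => by
    rw [← inner_self_eq_zero (𝕜 := ℂ), ← ContinuousLinearMap.inner_map_map_of_mem_unitary W.2, h,
      inner_zero_left]
  -- At `m = 0` the right side is `u - u = 0`. For `m < 0` the correction vanishes by orthogonality,
  -- so `P` kills every negative power applied to `u`.
  have hPstep : ∀ m : ℤ, (W : H →L[ℂ] H) (P (Wp (m - 1) u)) =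
      P (Wp m u) - ⟪u, Wp m u⟫_ℂ • u := fun m => by
    have h := hWP (Wp (m - 1) u)
    rw [hτinner', zero_smul, zero_sub, hWp, sub_add_cancel, sub_eq_iff_eq_add] at h
    rw [h, neg_add_eq_sub]
  have hPneg : ∀ n : ℕ, P (Wp (-(n : ℤ) - 1) u) = 0 := fun n => by
    refine hWinj _ ?_
    induction n with
    | zero => rw [hPstep, Nat.cast_zero, neg_zero, hWp0, huu, hPu, one_smul, sub_self]
    | succ n ih =>
      rw [hPstep, horth _ (by push_cast; omega), zero_smul, sub_zero, Nat.cast_succ, neg_add,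
        ← sub_eq_add_neg, hWinj _ ih]
  have hPu' : ∀ n : ℤ, P (Wp n u) = Wp n u ∨ P (Wp n u) = 0 := fun n => by
    rcases le_or_gt 0 n with h | h
    · obtain ⟨m, rfl⟩ := Int.eq_ofNat_of_zero_le h
      exact Or.inl (hPpos m)
    · obtain ⟨m, rfl⟩ : ∃ m : ℕ, n = -(m : ℤ) - 1 := ⟨(-n - 1).toNat, by omega⟩
      exact Or.inr (hPneg m)
  -- the orthonormal family
  let c : ℤˣ → H := fun σ => if σ = 1 then u else τ u
  -- The exponent is `x σ` because `(x + σ) σ = x σ + 1`: one application of `W` then moves the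
  -- label by `σ`.
  let w : ℤ × ℤˣ → H := fun i => Wp (i.1 * (i.2 : ℤ)) (c i.2)
  have hσ : ∀ σ : ℤˣ, σ = 1 ∨ σ = -1 := Int.units_eq_one_or
  have hc1 : c 1 = u := if_pos rfl
  have hc2 : c (-1) = τ u := if_neg (by decide)
  have hww : ∀ i, (W : H →L[ℂ] H) (w i) = w (shiftLabel i) := fun i => by
    have h : (i.1 + (i.2 : ℤ)) * (i.2 : ℤ) = i.1 * (i.2 : ℤ) + 1 := by
      rw [add_mul, Int.units_coe_mul_self]
    change (W : H →L[ℂ] H) (Wp (i.1 * (i.2 : ℤ)) (c i.2)) = Wp ((i.1 + (i.2 : ℤ)) * (i.2 : ℤ)) (c i.2)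
    rw [hWp, h]
  have hPw : ∀ i, P (w i) = w i ∨ P (w i) = 0 := by
    rintro ⟨n, σ⟩
    change P (Wp (n * (σ : ℤ)) (c σ)) = Wp (n * (σ : ℤ)) (c σ) ∨ P (Wp (n * (σ : ℤ)) (c σ)) = 0
    rcases hσ σ with rfl | rfl
    · rw [hc1]
      exact hPu' _
    · rw [hc2, ← neg_neg (n * _), ← hWpτ, ← hτP]
      rcases hPu' (-(n * ((-1 : ℤˣ) : ℤ))) with h | h
      · exact Or.inl (by rw [h])
      · exact Or.inr (by rw [h, map_zero])
  have horthτ : ∀ n : ℤ, n ≠ 0 → ⟪τ u, Wp n (τ u)⟫_ℂ = 0 := fun n hn => by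
    rw [← neg_neg n, ← hWpτ, inner_antiunitary, ← inner_conj_symm, horth _ (neg_ne_zero.2 hn),
      map_zero]
  have hw : Orthonormal ℂ w := by
    refine ⟨?_, ?_⟩
    · rintro ⟨n, σ⟩
      change ‖Wp (n * (σ : ℤ)) (c σ)‖ = 1
      rw [ContinuousLinearMap.norm_map_of_mem_unitary (W ^ (n * (σ : ℤ))).2]
      rcases hσ σ with rfl | rfl
      · rw [hc1, hu]
      · rw [hc2, LinearIsometryEquiv.norm_map, hu]
    · rintro ⟨m, σ⟩ ⟨n, ρ⟩ h
      change ⟪Wp (m * (σ : ℤ)) (c σ), Wp (n * (ρ : ℤ)) (c ρ)⟫_ℂ = 0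
      rw [hWpinner]
      rcases hσ σ with rfl | rfl <;> rcases hσ ρ with rfl | rfl
      · rw [hc1]
        refine horth _ fun h' => h ?_
        simp only [Units.val_one, mul_one, sub_eq_zero] at h'
        rw [h']
      · rw [hc1, hc2, hτinner]
      · rw [hc1, hc2, hτinner']
      · rw [hc2]
        refine horthτ _ fun h' => h ?_
        simp only [Units.val_neg, Units.val_one, mul_neg, mul_one, sub_eq_zero, neg_inj] at h'
        rw [h']
  let L : SpinChain →ₗᵢ[ℂ] H := hw.orthogonalFamily.linearIsometry
  have hL : ∀ f : SpinChain, HasSum (fun i => f i • w i) (L f) :=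
    fun f => hw.orthogonalFamily.hasSum_linearIsometry f
  have hLw : ∀ i, L (lp.single 2 i 1) = w i := fun i => by
    refine (hw.orthogonalFamily.linearIsometry_apply_single _).trans ?_
    simp
  have hWL : ∀ f : SpinChain, (W : H →L[ℂ] H) (L f) =
      L ((oppositeShifts : SpinChain →L[ℂ] SpinChain) f) := fun f => by
    have h1 := (hL f).mapL (W : H →L[ℂ] H)
    have h2 := (shiftLabel.hasSum_iff).2 (hL ((oppositeShifts : SpinChain →L[ℂ] SpinChain) f))
    refine h1.unique ?_
    convert! h2 using 2 with i
    rw [map_smul, hww, Function.comp_apply, oppositeShifts_apply, Equiv.symm_apply_apply]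
  let K : Submodule ℂ H := LinearMap.range L.toLinearMap
  have hKcl : IsClosed (K : Set H) := by
    have := L.isometry.isClosedEmbedding.isClosed_range
    convert! this
  have hwK : ∀ i, w i ∈ K := fun i => ⟨_, hLw i⟩
  have hPK : ∀ x ∈ K, P x ∈ K := by
    rintro _ ⟨f, rfl⟩
    refine hKcl.mem_of_tendsto ((hL f).mapL P) (Filter.Eventually.of_forall fun s =>
      Submodule.sum_mem _ fun i _ => ?_)
    rw [map_smul]
    refine K.smul_mem _ ?_
    rcases hPw i with h | h <;> rw [h]
    exacts [hwK i, K.zero_mem]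
  have hwinner : ∀ x ∈ Kᗮ, ∀ i, ⟪w i, x⟫_ℂ = 0 := fun x hx i =>
    (Submodule.mem_orthogonal _ _).1 hx _ (hwK i)
  refine ⟨K, L.equivRange, hKcl, hWL, fun x hx => ?_, hPK, fun x hx => ?_, fun x hx => ?_⟩
  · rw [Submodule.mem_orthogonal]
    rintro _ ⟨f, rfl⟩
    have h : f = (oppositeShifts : SpinChain →L[ℂ] SpinChain)
        (((oppositeShifts⁻¹ : unitary (SpinChain →L[ℂ] SpinChain)) : SpinChain →L[ℂ] SpinChain) f) := by
      rw [← mul_apply_eq_comp, ← Submonoid.coe_mul, mul_inv_cancel]; rfl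
    rw [h]
    change ⟪L _, _⟫_ℂ = 0
    rw [← hWL, ContinuousLinearMap.inner_map_map_of_mem_unitary W.2]
    exact (Submodule.mem_orthogonal _ _).1 hx _ ⟨_, rfl⟩
  · rw [Submodule.mem_orthogonal]
    intro y hy
    rw [← inner_apply_of_isSelfAdjoint hP.2]
    exact (Submodule.mem_orthogonal _ _).1 hx _ (hPK y hy)
  -- Both coefficients of the commutator vanish on `Kᗮ`, since `τ u` and `W⁻¹ u` belong to the
  -- family spanning `K`.
  · have h1 : ⟪τ u, x⟫_ℂ = 0 := by
      have := hwinner x hx (0, -1)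
      change ⟪Wp (0 * _) (c (-1)), x⟫_ℂ = 0 at this
      rwa [zero_mul, hWp0, hc2] at this
    have h2 : ⟪u, (W : H →L[ℂ] H) x⟫_ℂ = 0 := by
      have := hwinner x hx (-1, 1)
      change ⟪Wp (-1 * ((1 : ℤˣ) : ℤ)) (c 1), x⟫_ℂ = 0 at this
      rwa [← ContinuousLinearMap.inner_map_map_of_mem_unitary W.2, hWp, hc1, Units.val_one,
        mul_one, neg_add_cancel, hWp0] at this
    rw [← sub_eq_zero, hWP, h1, h2, zero_smul, zero_smul, sub_zero]

end ShiftStructure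

/-! ### The main theorem -/

theorem theorem2 {H : Type*} [NormedAddCommGroup H] [InnerProductSpace ℂ H] [CompleteSpace H]
    (U : unitary (H →L[ℂ] H)) (P : H →L[ℂ] H) (hP : IsStarProjection P)
    (A : H →L[ℂ] H) (hA : A = (U : H →L[ℂ] H) * P * star (U : H →L[ℂ] H) - P)
    (hAc : IsCompactOperator A)
    (τ : H ≃ₗᵢ⋆[ℂ] H) (hτ : ∀ x, τ (τ x) = -x)
    (hτU : ∀ x, τ ((U : H →L[ℂ] H) (τ.symm x)) = star (U : H →L[ℂ] H) x)
    (hτP : ∀ x, τ (P (τ.symm x)) = P x) :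
    ∃ W : unitary (H →L[ℂ] H),
      IsCompactOperator ((U : H →L[ℂ] H) - (W : H →L[ℂ] H)) ∧
      (∀ x, τ ((W : H →L[ℂ] H) (τ.symm x)) = star (W : H →L[ℂ] H) x) ∧
      -- even index: `W` commutes with `P`
      (Module.finrank ℂ (LinearMap.ker ((A - 1 : H →L[ℂ] H) : H →ₗ[ℂ] H)) % 2 = 0 →
        (W : H →L[ℂ] H) * P = P * (W : H →L[ℂ] H)) ∧
      -- odd index: `H` is the orthogonal sum of `K` and `Kᗮ`, both invariant under `W` and `P`;
      -- `W` acts on `K` as `S`, and its restriction to `Kᗮ` commutes with that of `P`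
      (Module.finrank ℂ (LinearMap.ker ((A - 1 : H →L[ℂ] H) : H →ₗ[ℂ] H)) % 2 = 1 →
        (∃ (K : Submodule ℂ H) (e : SpinChain ≃ₗᵢ[ℂ] K),
          IsClosed (K : Set H) ∧
          (∀ f : SpinChain, (W : H →L[ℂ] H) (e f) =
            e ((oppositeShifts : SpinChain →L[ℂ] SpinChain) f)) ∧
          (∀ x ∈ Kᗮ, (W : H →L[ℂ] H) x ∈ Kᗮ) ∧
          (∀ x ∈ K, P x ∈ K) ∧
          (∀ x ∈ Kᗮ, P x ∈ Kᗮ) ∧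
          (∀ x ∈ Kᗮ, (W : H →L[ℂ] H) (P x) = P ((W : H →L[ℂ] H) x))) ∧
        acSubspace oppositeShifts = ⊤ ∧
        acSpectrum oppositeShifts = Metric.sphere (0 : ℂ) 1) ∧
      -- Schatten classes
      (∀ p : ℝ, 0 < p → IsSchatten p A →
        IsSchatten p ((U : H →L[ℂ] H) - (W : H →L[ℂ] H))) := by
  set Q : H →L[ℂ] H := (U : H →L[ℂ] H) * P * star (U : H →L[ℂ] H) with hQdef
  have hUU : star (U : H →L[ℂ] H) * (U : H →L[ℂ] H) = 1 := (Unitary.mem_iff.1 U.2).1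
  have hUU' : (U : H →L[ℂ] H) * star (U : H →L[ℂ] H) = 1 := (Unitary.mem_iff.1 U.2).2
  have hUx : ∀ x, star (U : H →L[ℂ] H) ((U : H →L[ℂ] H) x) = x := fun x => congrArg (· x) hUU
  have hUx' : ∀ x, (U : H →L[ℂ] H) (star (U : H →L[ℂ] H) x) = x := fun x => congrArg (· x) hUU'
  have hQ : IsStarProjection Q := by
    refine ⟨?_, ?_⟩
    · rw [IsIdempotentElem, hQdef]
      calc (U : H →L[ℂ] H) * P * star (U : H →L[ℂ] H) * ((U : H →L[ℂ] H) * P * star (U : H →L[ℂ] H))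
          = (U : H →L[ℂ] H) * P * (star (U : H →L[ℂ] H) * (U : H →L[ℂ] H)) * P *
            star (U : H →L[ℂ] H) := by simp only [mul_assoc]
        _ = _ := by rw [hUU, mul_one, mul_assoc (U : H →L[ℂ] H), hP.1.eq]
    · rw [IsSelfAdjoint, hQdef, star_mul, star_mul, star_star, hP.2.star_eq, mul_assoc]
  have hQU : Q * (U : H →L[ℂ] H) = (U : H →L[ℂ] H) * P := by
    rw [hQdef, mul_assoc, hUU, mul_one]
  have hτU' : ∀ x, τ ((U : H →L[ℂ] H) x) = star (U : H →L[ℂ] H) (τ x) := fun x => by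
    rw [← hτU, LinearIsometryEquiv.symm_apply_apply]
  have hτP' : ∀ x, τ (P x) = P (τ x) := fun x => by
    rw [← hτP (τ x), LinearIsometryEquiv.symm_apply_apply]
  let θ : H ≃ₗᵢ⋆[ℂ] H := τ.trans (Unitary.linearIsometryEquiv U)
  have hθ_apply : ∀ x, θ x = (U : H →L[ℂ] H) (τ x) := fun x => rfl
  have hθ : ∀ x, θ (θ x) = -x := fun x => by
    rw [hθ_apply, hθ_apply, hτU', hτ, map_neg, map_neg, hUx']
  have hθP : ∀ x, θ (P x) = Q (θ x) := fun x => by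
    rw [hθ_apply, hθ_apply, hτP', ← mul_apply_eq_comp Q, hQU]
    rfl
  subst hA
  obtain ⟨V, hV, hVθ, ⟨E, C₀, C₁, C₂, hEfin, hC⟩, heven, hodd⟩ :=
    exists_decoupling hθ hP hQ hAc hθP
  have hτV : ∀ x, τ (V x) = star (U : H →L[ℂ] H) (star V (θ x)) := fun x => by
    rw [← hVθ, hθ_apply, hUx]
  let W : unitary (H →L[ℂ] H) := ⟨V, hV⟩ * U
  have hWx : ∀ x, (W : H →L[ℂ] H) x = V ((U : H →L[ℂ] H) x) := fun x => rfl
  have hWstar : star (W : H →L[ℂ] H) = star (U : H →L[ℂ] H) * star V := star_mul _ _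
  have hτW : ∀ x, τ ((W : H →L[ℂ] H) x) = star (W : H →L[ℂ] H) (τ x) := fun x => by
    rw [hWx, hτV, hθ_apply, hτU', hUx', hWstar]
    rfl
  have hUW : (U : H →L[ℂ] H) - (W : H →L[ℂ] H) =
      (E * C₀ + (Q - P) * C₁ + P * (Q - P) * C₂) * (U : H →L[ℂ] H) := by
    rw [← hC, sub_mul, one_mul]
    rfl
  refine ⟨W, ?_, fun x => ?_, fun h => ?_, fun h => ⟨?_, acSubspace_oppositeShifts,
    acSpectrum_oppositeShifts⟩, fun p hp hAp => ?_⟩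
  · rw [hUW]
    have h1 := (isCompactOperator_of_finiteDimensional_range E).comp_clm C₀
    have h2 := hAc.comp_clm C₁
    have h3 := (hAc.clm_comp P).comp_clm C₂
    exact ((h1.add h2).add h3).comp_clm (U : H →L[ℂ] H)
  · rw [hτW, LinearIsometryEquiv.apply_symm_apply]
  · calc (W : H →L[ℂ] H) * P = V * ((U : H →L[ℂ] H) * P) := mul_assoc _ _ _
      _ = V * Q * (U : H →L[ℂ] H) := by rw [← hQU, mul_assoc V Q]
      _ = P * (W : H →L[ℂ] H) := by rw [heven h, mul_assoc]; rfl
  · obtain ⟨f, hf, hPf, hPθf, hVf, hVθf, hcomm⟩ := hodd h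
    have hUτ : (U : H →L[ℂ] H) (τ (θ f)) = -f := by rw [← hθ_apply, hθ]
    have hWτ : (W : H →L[ℂ] H) (τ (θ f)) = -f := by rw [hWx, hUτ, map_neg, hVf]
    -- The seed is `θ f`, the member of the pair in the range of `P`; its partner satisfies `W τ (θ
    -- f) = -f`, which lies in the kernel of `P`.
    refine exists_oppositeShifts hτ hτW hP hτP' (u := θ f) ?_ hPθf ?_ fun x => ?_
    · rw [LinearIsometryEquiv.norm_map, hf]
    · rw [hWτ, map_neg, hPf, neg_zero]
    · have h1 : (W : H →L[ℂ] H) (P x) = V (Q ((U : H →L[ℂ] H) x)) := by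
        rw [← mul_apply_eq_comp Q, hQU]
        rfl
      have h2 : ⟪f, (U : H →L[ℂ] H) x⟫_ℂ = -⟪τ (θ f), x⟫_ℂ := by
        rw [← ContinuousLinearMap.inner_map_map_of_mem_unitary U.2 (τ (θ f)), hUτ, inner_neg_left,
          neg_neg]
      have h3 : ⟪θ f, (W : H →L[ℂ] H) x⟫_ℂ = ⟪θ f, (U : H →L[ℂ] H) x⟫_ℂ := by
        rw [hWx]
        nth_rewrite 1 [← hVθf]
        rw [ContinuousLinearMap.inner_map_map_of_mem_unitary hV]
      rw [h1, hWτ, h3, hWx, hcomm, h2, smul_neg, neg_smul]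
  · rw [hUW]
    have h1 := (isSchatten_of_finiteDimensional_range hp E).mul_right hp C₀
    have h2 := hAp.mul_right hp C₁
    have h3 := (hAp.mul_left hp P).mul_right hp C₂
    exact ((h1.add hp h2).add hp h3).mul_right hp _

end
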